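/- Work in units with $\hbar=1$ on the Hilbert space $L^2(\mathbb R)$, with position operator $X$ and momentum operator $P=-i\,d/dx$. For $(a,b)\neq(0,0)$ let $aX+bP+c$ denote the self-adjoint closure of this operator on Schwartz functions, and for self-adjoint $A$ let $\Theta(A)$ be its spectral projection on $[0,\infty)$. For $R\subset\mathbb R$ let $\mathcal S(R)$ be the set of density operators $\rho$ on $L^2(\mathbb R)$ with spatial support in $R$ (all functions in the range of $\rho$ vanish a.e. outside $R$). Put $\Omega:=\Theta(X+P)-\Theta(P)$ and, for $\alpha>0$, $$\varphi(\alpha):=\sup_{\rho\in\mathcal S([-\sqrt\alpha,0])}\operatorname{tr}(\rho\,\Omega).$$ For $M,L,\Delta T>0$ and $a\in\mathbb R$ put $$\Omega_F:=\Theta\!\left(X+\tfrac{\Delta T}{M}P-a\right)-\Theta\!\left(\tfrac{\Delta T}{M}P-a+L\right),\qquad \Omega_S:=\Theta\!\left(\tfrac{\Delta T}{M}P-a\right)-\Theta\!\left(X+\tfrac{\Delta T}{M}P-a\right),$$ $$\varphi_F(M,L,a,\Delta T):=\sup_{\rho\in\mathcal S([0,L])}\operatorname{tr}(\rho\,\Omega_F),\qquad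 \varphi_S(M,L,a,\Delta T):=\sup_{\rho\in\mathcal S([0,L])}\operatorname{tr}(\rho\,\Omega_S).$$ **Theorem.** Let $M,L,\Delta T>0$, $a\in\mathbb R$ and $\alpha:=ML^2/\Delta T$. The three suprema $\varphi(\alpha)$, $\varphi_F(M,L,a,\Delta T)$ and $\varphi_S(M,L,a,\Delta T)$ are suprema of non-empty bounded sets of real numbers, and $$\varphi_F(M,L,a,\Delta T)=\varphi(\alpha)=\varphi_S(M,L,a,\Delta T).$$ In particular $\varphi_F(M,L,a,\Delta T)$ does not depend on $a$. Moreover: 1. there is a unitary operator $V$ on $L^2(\mathbb R)$ with $VXV^\dagger=\sqrt{\tfrac{M}{\Delta T}}\,(X-L)$ and $VPV^\dagger=\sqrt{\tfrac{\Delta T}{M}}\,P-\sqrt{\tfrac{M}{\Delta T}}\,(a-L)$, such that $V\,\mathcal S([-\sqrt\alpha,0])\,V^\dagger=\mathcal S([0,L])$ and $V\Omega V^\dagger=\Omega_F$; 2. there is an anti-unitary operator $U$ on $L^2(\mathbb R)$ with $UXU^\dagger=-\sqrt{\tfrac{M}{\Delta T}}\,X$ and $UPU^\dagger=\sqrt{\tfrac{\Delta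 T}{M}}\,P+\sqrt{\tfrac{M}{\Delta T}}\,(X-a)$, such that $U\,\mathcal S([-\sqrt\alpha,0])\,U^\dagger=\mathcal S([0,L])$ and $U\Omega U^\dagger=\Omega_S$. -/

import Mathlib

open MeasureTheory SchwartzMap
open scoped ENNReal NNReal

noncomputable section

namespace Projectile

/-- The Hilbert space `L²(ℝ; ℂ)` of a particle on the line, in position representation. -/
abbrev H : Type := Lp ℂ 2 (volume : Measure ℝ)

/-! ### The operators `a X + b P + c` -/

/-- Multiplication by `x` on Schwartz functions. -/
def positionS : 𝓢(ℝ, ℂ) →ₗ[ℂ] 𝓢(ℝ, ℂ) :=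
  (SchwartzMap.smulLeftCLM ℂ (fun x : ℝ => (x : ℂ))).toLinearMap

/-- `-i d/dx` on Schwartz functions (units with `ħ = 1`). -/
def momentumS : 𝓢(ℝ, ℂ) →ₗ[ℂ] 𝓢(ℝ, ℂ) :=
  (-Complex.I) • (SchwartzMap.derivCLM ℂ ℂ).toLinearMap

theorem positionS_apply (f : 𝓢(ℝ, ℂ)) (x : ℝ) : positionS f x = x * f x := by
  have h : Function.HasTemperateGrowth (fun x : ℝ => (x : ℂ)) :=
    Complex.ofRealCLM.hasTemperateGrowth
  simp [positionS, SchwartzMap.smulLeftCLM_apply_apply h]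

theorem momentumS_apply (f : 𝓢(ℝ, ℂ)) (x : ℝ) :
    momentumS f x = -Complex.I * deriv f x := by
  simp [momentumS]

/-- `a X + b P + c` on Schwartz functions. -/
def phaseS (a b c : ℝ) : 𝓢(ℝ, ℂ) →ₗ[ℂ] 𝓢(ℝ, ℂ) :=
  (a : ℂ) • positionS + (b : ℂ) • momentumS + (c : ℂ) • LinearMap.id

/-- The inclusion of the Schwartz functions into `L²`. -/
def schwartzToH : 𝓢(ℝ, ℂ) →ₗ[ℂ] H :=
  (SchwartzMap.toLpCLM ℂ ℂ 2 (volume : Measure ℝ)).toLinearMap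

theorem schwartzToH_injective : Function.Injective schwartzToH :=
  SchwartzMap.injective_toLp (F := ℂ) 2 (volume : Measure ℝ)

/-- `a X + b P + c` as an unbounded operator on `L²` whose domain is the Schwartz space. -/
def phaseOpCore (a b c : ℝ) : H →ₗ.[ℂ] H where
  domain := LinearMap.range schwartzToH
  toFun := schwartzToH ∘ₗ phaseS a b c ∘ₗ
    (LinearEquiv.ofInjective schwartzToH schwartzToH_injective).symm.toLinearMap

/-- The operator `a X + b P + c` (self-adjoint): the closure of its restriction to the Schwartz
space, on which it is essentially self-adjoint. -/
def phaseOp (a b c : ℝ) : H →ₗ.[ℂ] H := (phaseOpCore a b c).closure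

/-- The position operator `X`. -/
def X : H →ₗ.[ℂ] H := phaseOp 1 0 0

/-- The momentum operator `P`. -/
def P : H →ₗ.[ℂ] H := phaseOp 0 1 0

/-! ### Functional calculus for unbounded self-adjoint operators -/

/-- A projection-valued measure on the Borel sets of `ℝ`, with values in the orthogonal
projections of `H`; countable additivity is in the strong sense. -/
structure PVM where
  proj : Set ℝ → (H →L[ℂ] H)
  isStarProjection : ∀ S, MeasurableSet S → IsStarProjection (proj S)
  univ : proj Set.univ = 1
  inter : ∀ S T, MeasurableSet S → MeasurableSet T → proj (S ∩ T) = proj S * proj T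
  hasSum_iUnion : ∀ S : ℕ → Set ℝ, (∀ n, MeasurableSet (S n)) →
    Pairwise (fun m n => Disjoint (S m) (S n)) →
    ∀ ψ : H, HasSum (fun n => proj (S n) ψ) (proj (⋃ n, S n) ψ)

namespace PVM

theorem inner_eq (E : PVM) {S : Set ℝ} (hS : MeasurableSet S) (ψ : H) :
    inner ℂ ψ (E.proj S ψ) = ((‖E.proj S ψ‖ ^ 2 : ℝ) : ℂ) := by
  have h := E.isStarProjection S hS
  have h1 : E.proj S (E.proj S ψ) = E.proj S ψ := by
    have := congrArg (fun T : H →L[ℂ] H => T ψ) h.isIdempotentElem.eq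
    simpa using this
  have h2 : ContinuousLinearMap.adjoint (E.proj S) = E.proj S := h.isSelfAdjoint
  have h3 : inner ℂ (E.proj S ψ) (E.proj S ψ) = inner ℂ ψ (E.proj S ψ) := by
    conv_lhs => arg 2; rw [← h2]
    rw [h2, ← ContinuousLinearMap.adjoint_inner_right, h2, h1]
  rw [← h3, inner_self_eq_norm_sq_to_K]
  simp

theorem proj_empty (E : PVM) : E.proj ∅ = 0 := by
  ext1 ψ
  have h := E.hasSum_iUnion (fun _ => ∅) (fun _ => MeasurableSet.empty)
    (fun _ _ _ => disjoint_bot_left) ψ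
  simpa using tendsto_nhds_unique tendsto_const_nhds h.summable.tendsto_atTop_zero

/-- The spectral distribution `S ↦ ⟨ψ, E(S) ψ⟩ = ‖E(S) ψ‖²` of the vector `ψ`. -/
def diag (E : PVM) (ψ : H) : Measure ℝ :=
  Measure.ofMeasurable (fun S _ => ENNReal.ofReal (‖E.proj S ψ‖ ^ 2))
    (by simp [E.proj_empty])
    (by
      intro S hS hd
      have h := (E.hasSum_iUnion S hS hd ψ).mapL (innerSL ℂ ψ)
      have h' : HasSum (fun n => ‖E.proj (S n) ψ‖ ^ 2) (‖E.proj (⋃ n, S n) ψ‖ ^ 2) := by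
        have := Complex.hasSum_re h
        simpa [E.inner_eq (hS _), E.inner_eq (MeasurableSet.iUnion hS), ← Complex.ofReal_pow]
          using this
      rw [← h'.tsum_eq, ENNReal.ofReal_tsum_of_nonneg (fun _ => by positivity) h'.summable])

theorem diag_apply (E : PVM) (ψ : H) {S : Set ℝ} (hS : MeasurableSet S) :
    E.diag ψ S = ENNReal.ofReal (‖E.proj S ψ‖ ^ 2) :=
  Measure.ofMeasurable_apply S hS

end PVM

/-- `E` is the spectral measure of the unbounded operator `A`, that is `A = ∫ λ dE(λ)`: the domain
of `A` is the set of all `ψ` with `∫ λ² d⟨ψ, E(λ) ψ⟩ < ∞`, and on it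
`⟨ψ, A ψ⟩ = ∫ λ d⟨ψ, E(λ) ψ⟩`. -/
structure IsSpectralMeasure (A : H →ₗ.[ℂ] H) (E : PVM) : Prop where
  mem_domain_iff : ∀ ψ : H, ψ ∈ A.domain ↔ Integrable (fun t : ℝ => t ^ 2) (E.diag ψ)
  inner_eq : ∀ ψ : A.domain,
    inner ℂ (ψ : H) (A ψ) = ((∫ t : ℝ, t ∂(E.diag (ψ : H)) : ℝ) : ℂ)

open Classical in
/-- `Θ(A)` for a self-adjoint operator `A`, with `Θ` the Heaviside function `1_{[0,∞)}`: the value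
at `[0,∞)` of the spectral measure of `A`, which exists and is unique by the spectral theorem
(the value for other operators is a convention). -/
def heaviside (A : H →ₗ.[ℂ] H) : H →L[ℂ] H :=
  if h : ∃ E : PVM, IsSpectralMeasure A E then h.choose.proj (Set.Ici 0) else 0

/-! ### Trace and quantum states -/

/-- `T` is of trace class with trace `t`: in every orthonormal basis the diagonal matrix elements
are summable, with sum `t`. -/
def HasTrace (T : H →L[ℂ] H) (t : ℂ) : Prop :=
  ∀ (ι : Type) (e : HilbertBasis ι ℂ H), HasSum (fun i => inner ℂ (e i) (T (e i))) t

open Classical in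
/-- The trace of a trace class operator. -/
def trace (T : H →L[ℂ] H) : ℂ :=
  if h : ∃ t : ℂ, HasTrace T t then h.choose else 0

/-- `S(R)`: the quantum states (density operators: positive, of trace one) with spatial support
in `R`, i.e. whose range consists of wave functions that vanish almost everywhere outside `R`. -/
def states (R : Set ℝ) : Set (H →L[ℂ] H) :=
  {ρ | ρ.IsPositive ∧ HasTrace ρ 1 ∧ ∀ ψ : H, ∀ᵐ x : ℝ, x ∉ R → ρ ψ x = 0}

/-! ### The optimization problems -/

/-- The set of all values `tr(ρ A)` with `ρ ∈ S(R)` (real numbers when `A` is self-adjoint). -/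
def values (R : Set ℝ) (A : H →L[ℂ] H) : Set ℝ :=
  {v | ∃ ρ ∈ states R, v = (trace (ρ * A)).re}

/-- `Ω = Θ(X + P) - Θ(P)`. -/
def OmegaStd : H →L[ℂ] H := heaviside (phaseOp 1 1 0) - heaviside P

/-- `Ω_F = Θ(X + (ΔT/M) P - a) - Θ((ΔT/M) P - a + L)`. -/
def OmegaF (M L a ΔT : ℝ) : H →L[ℂ] H :=
  heaviside (phaseOp 1 (ΔT / M) (-a)) - heaviside (phaseOp 0 (ΔT / M) (-a + L))

/-- `Ω_S = Θ((ΔT/M) P - a) - Θ(X + (ΔT/M) P - a)`. -/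
def OmegaS (M a ΔT : ℝ) : H →L[ℂ] H :=
  heaviside (phaseOp 0 (ΔT / M) (-a)) - heaviside (phaseOp 1 (ΔT / M) (-a))

/-- The solution `φ(α)` of the standard problem. -/
def phi (α : ℝ) : ℝ := sSup (values (Set.Icc (-√α) 0) OmegaStd)

/-- The maximal ultrafast advantage. -/
def phiF (M L a ΔT : ℝ) : ℝ := sSup (values (Set.Icc 0 L) (OmegaF M L a ΔT))

/-- The maximal ultraslow advantage. -/
def phiS (M L a ΔT : ℝ) : ℝ := sSup (values (Set.Icc 0 L) (OmegaS M a ΔT))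

/-! ### Conjugation by unitary and anti-unitary operators -/

section Conjugation

variable {σ : ℂ →+* ℂ} [RingHomInvPair σ σ] [RingHomCompTriple σ σ (RingHom.id ℂ)]

/-- `U T U†` for a bounded operator `T`, with `U` unitary (`σ` the identity) or anti-unitary (`σ`
complex conjugation). -/
def conj (U : H ≃ₛₗᵢ[σ] H) (T : H →L[ℂ] H) : H →L[ℂ] H :=
  ((U.toContinuousLinearEquiv : H →SL[σ] H).comp
    (T.comp (U.symm.toContinuousLinearEquiv : H →SL[σ] H)) : H →SL[RingHom.id ℂ] H)

theorem conj_apply (U : H ≃ₛₗᵢ[σ] H) (T : H →L[ℂ] H) (ψ : H) :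
    conj U T ψ = U (T (U.symm ψ)) := rfl

/-- `U A U† = B` for unbounded operators `A`, `B`: the map `U × U` takes the graph of `A` onto the
graph of `B`. -/
def ConjEq (U : H ≃ₛₗᵢ[σ] H) (A B : H →ₗ.[ℂ] H) : Prop :=
  ∀ ψ χ : H, (ψ, χ) ∈ A.graph ↔ (U ψ, U χ) ∈ B.graph

end Conjugation

end Projectile

end

/-!
Conjugation by a metaplectic operator `(W f)(x) = √|s| exp(i (k x + m x² / 2)) σ(f(s x + d))`, with
`σ` the identity (unitary case) or complex conjugation (anti-unitary case), maps the operators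
`a X + b P + c` onto operators of the same form, by an affine transformation of the phase plane
(`metaplectic_mem_graph_iff`). On Schwartz functions this is a computation with derivatives. It
passes to the closures because `W × W` is a homeomorphism that carries the graph of one core onto
the graph of the other, and because the cores are symmetric, hence closable.

With `s = √(M / ΔT)`, the choice `d = -s L`, `k = s² (a - L)`, `m = 0` gives the unitary operator of
the ultrafast problem, and complex conjugation with `-s` in place of `s`, `d = 0`, `k = s² a`,
`m = -s²` gives the anti-unitary operator of the ultraslow problem. Both substitutions
`x ↦ s (x - L)` and `x ↦ -s x` carry `[0, L]` onto `[-s L, 0] = [-√α, 0]`, so states are carried to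
states with the required support. The operators `X + P` and `P` are carried to positive multiples
of the operators in `Ω_F` and `Ω_S`; positive factors do not change `Θ`.

That `Θ(r U A U†) = U Θ(A) U†` for `r > 0` (`conj_heaviside`) rests on the uniqueness of the
spectral measure at `[0, ∞)` (`IsSpectralMeasure.proj_Ici_unique`). If `E` and `F` are spectral
measures of `A`, then `A` commutes with their projections; on the range of `E [0, 2c]` the powers
`(A - c) ^ n` are bounded by `c ^ n`, while on the range of `F (-∞, -ε]` they are bounded below by
`(c + ε) ^ n`. Hence `F (-∞, -ε] E [0, 2c] = 0`, and exhausting the two half-lines shows that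
`F (-∞, 0)` and `E [0, ∞)` are orthogonal.

Traces are invariant under conjugation up to complex conjugation, so the three sets of values
coincide. They are bounded by the Hilbert–Schmidt estimate `abs_re_trace_mul_le`, and non-empty
because of the pure state of a normalized indicator function.
-/

noncomputable section

namespace Projectile

/-! ### Projection-valued measures -/

namespace PVM

variable (E : PVM)

theorem proj_proj {S T : Set ℝ} (hS : MeasurableSet S) (hT : MeasurableSet T) (ψ : H) :
    E.proj S (E.proj T ψ) = E.proj (S ∩ T) ψ := by
  rw [E.inter S T hS hT]; rfl

theorem norm_proj_le {S : Set ℝ} (hS : MeasurableSet S) (ψ : H) : ‖E.proj S ψ‖ ≤ ‖ψ‖ := by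
  have h := (E.proj S).le_of_opNorm_le ((E.isStarProjection S hS).norm_le) ψ
  simpa using h

theorem inner_proj_left {S : Set ℝ} (hS : MeasurableSet S) (φ ψ : H) :
    inner ℂ (E.proj S φ) ψ = inner ℂ φ (E.proj S ψ) := by
  have h2 : ContinuousLinearMap.adjoint (E.proj S) = E.proj S :=
    (E.isStarProjection S hS).isSelfAdjoint
  conv_rhs => rw [← h2, ContinuousLinearMap.adjoint_inner_right]

theorem inner_proj_proj_of_disjoint {S T : Set ℝ} (hS : MeasurableSet S) (hT : MeasurableSet T)
    (hd : S ∩ T = ∅) (φ ψ : H) : inner ℂ (E.proj S φ) (E.proj T ψ) = 0 := by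
  rw [E.inner_proj_left hS, E.proj_proj hS hT, hd, E.proj_empty]; simp

theorem diag_univ (ψ : H) : E.diag ψ Set.univ = ENNReal.ofReal (‖ψ‖ ^ 2) := by
  rw [E.diag_apply ψ MeasurableSet.univ, E.univ]; simp

instance (ψ : H) : IsFiniteMeasure (E.diag ψ) :=
  ⟨by rw [E.diag_univ]; exact ENNReal.ofReal_lt_top⟩

theorem diag_real_univ (ψ : H) : (E.diag ψ).real Set.univ = ‖ψ‖ ^ 2 := by
  rw [Measure.real, E.diag_univ, ENNReal.toReal_ofReal (by positivity)]

theorem diag_proj {S : Set ℝ} (hS : MeasurableSet S) (ψ : H) :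
    E.diag (E.proj S ψ) = (E.diag ψ).restrict S := by
  ext T hT
  rw [Measure.restrict_apply hT, E.diag_apply _ hT, E.diag_apply _ (hT.inter hS),
    E.proj_proj hT hS]

theorem proj_eq_zero_iff {S : Set ℝ} (hS : MeasurableSet S) (ψ : H) :
    E.proj S ψ = 0 ↔ E.diag ψ S = 0 := by
  rw [E.diag_apply ψ hS, ENNReal.ofReal_eq_zero]
  constructor
  · intro h; simp [h]
  · intro h
    have : ‖E.proj S ψ‖ = 0 := by nlinarith [norm_nonneg (E.proj S ψ)]
    simpa using this

theorem proj_iUnion_eq_zero {S : ℕ → Set ℝ} (hS : ∀ n, MeasurableSet (S n)) {ψ : H}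
    (h : ∀ n, E.proj (S n) ψ = 0) : E.proj (⋃ n, S n) ψ = 0 := by
  rw [E.proj_eq_zero_iff (MeasurableSet.iUnion hS)]
  exact measure_iUnion_null fun n => (E.proj_eq_zero_iff (hS n) ψ).1 (h n)

theorem proj_add_proj_compl {S : Set ℝ} (hS : MeasurableSet S) (ψ : H) :
    E.proj S ψ + E.proj Sᶜ ψ = ψ := by
  have h0 : E.proj Sᶜ (ψ - E.proj S ψ - E.proj Sᶜ ψ) = 0 := by
    simp only [map_sub, E.proj_proj hS.compl hS, E.proj_proj hS.compl hS.compl]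
    simp [E.proj_empty]
  have h1 : E.proj S (ψ - E.proj S ψ - E.proj Sᶜ ψ) = 0 := by
    simp only [map_sub, E.proj_proj hS hS.compl, E.proj_proj hS hS]
    simp [E.proj_empty]
  have h2 : E.diag (ψ - E.proj S ψ - E.proj Sᶜ ψ) Set.univ = 0 := by
    rw [← Set.union_compl_self S]
    exact measure_union_null ((E.proj_eq_zero_iff hS _).1 h1)
      ((E.proj_eq_zero_iff hS.compl _).1 h0)
  rw [← E.proj_eq_zero_iff MeasurableSet.univ, E.univ] at h2
  have h3 : ψ - E.proj S ψ - E.proj Sᶜ ψ = 0 := h2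
  rw [sub_sub, sub_eq_zero] at h3
  exact h3.symm

/-- Vectors in the ranges of `E S` and `E Sᶜ` do not interfere in the spectral distribution. -/
theorem diag_add_of_compl {S : Set ℝ} (hS : MeasurableSet S) {φ ψ : H}
    (hφ : E.proj S φ = φ) (hψ : E.proj Sᶜ ψ = ψ) :
    E.diag (φ + ψ) = E.diag φ + E.diag ψ := by
  ext T hT
  rw [Measure.add_apply, E.diag_apply _ hT, E.diag_apply _ hT, E.diag_apply _ hT,
    ← ENNReal.ofReal_add (by positivity) (by positivity), map_add]
  congr 1
  have h : inner ℂ (E.proj T φ) (E.proj T ψ) = 0 := by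
    rw [← hφ, ← hψ, E.proj_proj hT hS, E.proj_proj hT hS.compl]
    refine E.inner_proj_proj_of_disjoint (hT.inter hS) (hT.inter hS.compl) ?_ _ _
    ext x; simp; tauto
  have := norm_add_sq_eq_norm_sq_add_norm_sq_of_inner_eq_zero _ _ h
  simpa [sq] using this

end PVM

/-! ### Uniqueness of the spectral measure -/

namespace IsSpectralMeasure

variable {A : H →ₗ.[ℂ] H} {E : PVM} (hE : IsSpectralMeasure A E)

include hE

theorem proj_mem_domain {S : Set ℝ} (hS : MeasurableSet S) {ψ : H} (hψ : ψ ∈ A.domain) :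
    E.proj S ψ ∈ A.domain := by
  rw [hE.mem_domain_iff, E.diag_proj hS]
  exact ((hE.mem_domain_iff ψ).1 hψ).restrict

theorem proj_Icc_mem_domain (a b : ℝ) (ψ : H) : E.proj (Set.Icc a b) ψ ∈ A.domain := by
  rw [hE.mem_domain_iff, E.diag_proj measurableSet_Icc]
  exact (continuous_pow 2).continuousOn.integrableOn_Icc

theorem integrable_id (ψ : A.domain) : Integrable (fun t : ℝ => t) (E.diag (ψ : H)) := by
  have h := (hE.mem_domain_iff ψ).1 ψ.2
  refine Integrable.mono' (h.add (integrable_const (1 : ℝ))) (by fun_prop) (ae_of_all _ fun t => ?_)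
  simp only [Pi.add_apply, Real.norm_eq_abs]
  nlinarith [sq_abs t, sq_nonneg (|t| - 1), abs_nonneg t]

/-- `A` is symmetric, by polarization of its real quadratic form. -/
theorem inner_symm (φ ψ : A.domain) : inner ℂ (A φ) (ψ : H) = inner ℂ (φ : H) (A ψ) := by
  have real : ∀ χ : A.domain, (inner ℂ (χ : H) (A χ)).im = 0 := fun χ => by
    rw [hE.inner_eq]; exact Complex.ofReal_im _
  have h1 := real (φ + ψ)
  have h2 := real (φ + Complex.I • ψ)
  have h3 := real φ
  have h4 := real ψ
  simp only [A.map_add, A.map_smul, Submodule.coe_add, Submodule.coe_smul, inner_add_left,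
    inner_add_right, inner_smul_left, inner_smul_right, Complex.add_im, h3, h4, zero_add, add_zero,
    Complex.conj_I] at h1 h2
  rw [← inner_conj_symm (A φ) (ψ : H)]
  simp only [mul_add, Complex.add_im, ← mul_assoc, neg_mul, Complex.I_mul_I, mul_neg, neg_neg,
    one_mul, h4, add_zero] at h2
  generalize inner ℂ (ψ : H) (A φ) = p at h1 h2 ⊢
  generalize inner ℂ (φ : H) (A ψ) = q at h1 h2 ⊢
  apply Complex.ext
  · simp at h2 ⊢
    linarith
  · simp at h1 ⊢
    linarith

/-- The matrix elements of `A` between the ranges of `E S` and `E Sᶜ` vanish: the quadratic form is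
additive there, so the cross terms cancel, for `ψ` as well as for `i ψ`. -/
theorem inner_eq_zero_of_compl {S : Set ℝ} (hS : MeasurableSet S) {φ ψ : A.domain}
    (hφ : E.proj S φ = φ) (hψ : E.proj Sᶜ ψ = ψ) : inner ℂ (φ : H) (A ψ) = 0 := by
  have key : ∀ χ : A.domain, E.proj Sᶜ χ = χ →
      inner ℂ (φ : H) (A χ) + inner ℂ (χ : H) (A φ) = 0 := by
    intro χ hχ
    have h := hE.inner_eq (φ + χ)
    have h' : ((φ + χ : A.domain) : H) = (φ : H) + χ := rfl
    rw [h', E.diag_add_of_compl hS hφ hχ,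
      integral_add_measure (hE.integrable_id φ) (hE.integrable_id χ), Complex.ofReal_add,
      ← hE.inner_eq, ← hE.inner_eq, A.map_add, inner_add_left, inner_add_right,
      inner_add_right] at h
    linear_combination h
  have h1 := key ψ hψ
  have h2 := key (Complex.I • ψ) (by simp [hψ])
  simp only [A.map_smul, Submodule.coe_smul, inner_smul_left, inner_smul_right,
    Complex.conj_I] at h2
  have h3 : (2 * Complex.I) * inner ℂ (φ : H) (A ψ) = 0 := by
    linear_combination h2 + Complex.I * h1
  simpa using h3

/-- `A` maps the range of `E Sᶜ` into itself: `E S (A ψ)` is orthogonal to its own truncations to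
bounded spectral intervals, which lie in the domain. -/
theorem proj_apply_eq_zero {S : Set ℝ} (hS : MeasurableSet S) {ψ : A.domain}
    (hψ : E.proj Sᶜ ψ = ψ) : E.proj S (A ψ) = 0 := by
  have h : ∀ n : ℕ, E.proj (S ∩ Set.Icc (-(n : ℝ)) n) (A ψ) = 0 := by
    intro n
    have hI : MeasurableSet (Set.Icc (-(n : ℝ)) n) := measurableSet_Icc
    have hmem : E.proj (S ∩ Set.Icc (-(n : ℝ)) n) (A ψ) ∈ A.domain := by
      rw [Set.inter_comm, ← E.proj_proj hI hS]
      exact hE.proj_Icc_mem_domain _ _ _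
    have h0 := hE.inner_eq_zero_of_compl hS (φ := ⟨_, hmem⟩) (ψ := ψ)
      (by simp only [E.proj_proj hS (hS.inter hI)]
          rw [← Set.inter_assoc, Set.inter_self]) hψ
    rw [E.inner_proj_left (hS.inter hI), E.inner_eq (hS.inter hI)] at h0
    simpa using h0
  have hU : S = ⋃ n : ℕ, S ∩ Set.Icc (-(n : ℝ)) n := by
    rw [← Set.inter_iUnion]
    refine (Set.inter_eq_left.2 fun x _ => ?_).symm
    obtain ⟨n, hn⟩ := exists_nat_ge |x|
    exact Set.mem_iUnion.2 ⟨n, abs_le.1 hn⟩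
  rw [hU]
  exact E.proj_iUnion_eq_zero (fun n => hS.inter measurableSet_Icc) h

/-- `A` commutes with its spectral projections. -/
theorem apply_proj {S : Set ℝ} (hS : MeasurableSet S) (ψ : A.domain) :
    A ⟨E.proj S ψ, hE.proj_mem_domain hS ψ.2⟩ = E.proj S (A ψ) := by
  set φ₁ : A.domain := ⟨E.proj S ψ, hE.proj_mem_domain hS ψ.2⟩
  set φ₂ : A.domain := ⟨E.proj Sᶜ ψ, hE.proj_mem_domain hS.compl ψ.2⟩
  have hsum : ψ = φ₁ + φ₂ := Subtype.ext (E.proj_add_proj_compl hS ψ).symm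
  have h1 : E.proj Sᶜ (A φ₁) = 0 := hE.proj_apply_eq_zero hS.compl (by
    simp [φ₁, E.proj_proj hS hS])
  have h2 : E.proj S (A φ₂) = 0 := hE.proj_apply_eq_zero hS (by
    simp [φ₂, E.proj_proj hS.compl hS.compl])
  have h3 := E.proj_add_proj_compl hS (A φ₁)
  rw [h1, add_zero] at h3
  rw [hsum, A.map_add, map_add, h2, h3, add_zero]

/-- On the range of `E (-∞, -ε]` the operator `A - c` is bounded below by `c + ε`. -/
theorem norm_sub_ge {ε c : ℝ} (φ : A.domain)
    (hφ : E.proj (Set.Iic (-ε)) φ = φ) : (c + ε) * ‖(φ : H)‖ ≤ ‖A φ - (c : ℂ) • (φ : H)‖ := by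
  have hint : ∫ t, t ∂(E.diag (φ : H)) ≤ -ε * ‖(φ : H)‖ ^ 2 := by
    have hae : ∀ᵐ t ∂(E.diag (φ : H)), t ≤ -ε := by
      rw [← hφ, E.diag_proj measurableSet_Iic]
      exact ae_restrict_mem measurableSet_Iic
    calc ∫ t, t ∂(E.diag (φ : H)) ≤ ∫ _, -ε ∂(E.diag (φ : H)) :=
          integral_mono_ae (hE.integrable_id φ) (integrable_const _) hae
      _ = -ε * ‖(φ : H)‖ ^ 2 := by
          rw [integral_const, E.diag_real_univ, smul_eq_mul, mul_comm]
  have h1 : inner ℂ (φ : H) (A φ - (c : ℂ) • (φ : H)) =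
      ((∫ t, t ∂(E.diag (φ : H)) - c * ‖(φ : H)‖ ^ 2 : ℝ) : ℂ) := by
    rw [inner_sub_right, inner_smul_right, hE.inner_eq, inner_self_eq_norm_sq_to_K]
    push_cast; rfl
  have h2 := norm_inner_le_norm (𝕜 := ℂ) (φ : H) (A φ - (c : ℂ) • (φ : H))
  rw [h1, Complex.norm_real, Real.norm_eq_abs] at h2
  have h3 := neg_abs_le (∫ t, t ∂(E.diag (φ : H)) - c * ‖(φ : H)‖ ^ 2)
  rcases (norm_nonneg (φ : H)).eq_or_lt with h0 | h0
  · rw [← h0, mul_zero]; positivity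
  · refine le_of_mul_le_mul_left ?_ h0
    nlinarith

/-- On the range of `E [0, 2c]` the operator `A - c` is bounded by `c`. -/
theorem norm_sub_le {c : ℝ} (hc : 0 < c) (φ : A.domain)
    (hφ : E.proj (Set.Icc 0 (2 * c)) φ = φ) : ‖A φ - (c : ℂ) • (φ : H)‖ ≤ c * ‖(φ : H)‖ := by
  have hm : MeasurableSet (Set.Icc 0 (2 * c)) := measurableSet_Icc
  -- the quadratic form of `A - c` is bounded by `c` on the range of the projection
  have quad : ∀ χ : A.domain, E.proj (Set.Icc 0 (2 * c)) χ = χ →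
      |(inner ℂ (χ : H) (A χ - (c : ℂ) • (χ : H))).re| ≤ c * ‖(χ : H)‖ ^ 2 := by
    intro χ hχ
    have hae : ∀ᵐ t ∂(E.diag (χ : H)), t ∈ Set.Icc 0 (2 * c) := by
      rw [← hχ, E.diag_proj hm]
      exact ae_restrict_mem hm
    have h1 : 0 ≤ ∫ t, t ∂(E.diag (χ : H)) :=
      integral_nonneg_of_ae (hae.mono fun t ht => ht.1)
    have h2 : ∫ t, t ∂(E.diag (χ : H)) ≤ 2 * c * ‖(χ : H)‖ ^ 2 := by
      calc ∫ t, t ∂(E.diag (χ : H)) ≤ ∫ _, 2 * c ∂(E.diag (χ : H)) :=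
            integral_mono_ae (hE.integrable_id χ) (integrable_const _) (hae.mono fun t ht => ht.2)
        _ = 2 * c * ‖(χ : H)‖ ^ 2 := by
            rw [integral_const, E.diag_real_univ, smul_eq_mul, mul_comm]
    have h3 : inner ℂ (χ : H) (A χ - (c : ℂ) • (χ : H)) =
        ((∫ t, t ∂(E.diag (χ : H)) - c * ‖(χ : H)‖ ^ 2 : ℝ) : ℂ) := by
      rw [inner_sub_right, inner_smul_right, hE.inner_eq, inner_self_eq_norm_sq_to_K]
      push_cast; rfl
    rw [h3, Complex.ofReal_re, abs_le]
    constructor <;> linarith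
  set y : H := A φ - (c : ℂ) • (φ : H) with hy
  have hyfix : E.proj (Set.Icc 0 (2 * c)) y = y := by
    have h := hE.apply_proj hm φ
    have h' : (⟨E.proj (Set.Icc 0 (2 * c)) φ, hE.proj_mem_domain hm φ.2⟩ : A.domain) = φ :=
      Subtype.ext hφ
    rw [h'] at h
    rw [hy, map_sub, map_smul, ← h, hφ]
  have hymem : y ∈ A.domain := by
    rw [← hyfix]; exact hE.proj_Icc_mem_domain _ _ _
  -- polarize between `φ` and `z = y / c`
  set z : A.domain := ((1 / c : ℝ) : ℂ) • ⟨y, hymem⟩ with hz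
  have hzfix : E.proj (Set.Icc 0 (2 * c)) z = z := by
    rw [hz, Submodule.coe_smul, map_smul, hyfix]
  have q1 := (abs_le.1 (quad (φ + z) (by simp [hφ, hzfix]))).2
  have q2 := (abs_le.1 (quad (φ - z) (by simp [hφ, hzfix]))).1
  have par := parallelogram_law_with_norm ℂ (φ : H) (z : H)
  have hzy : (z : H) = ((1 / c : ℝ) : ℂ) • y := rfl
  have hnz : ‖(z : H)‖ = 1 / c * ‖y‖ := by
    rw [hzy, norm_smul, Complex.norm_real, Real.norm_of_nonneg (by positivity)]
  have e1 : A (φ + z) - (c : ℂ) • ((φ + z : A.domain) : H) = y + (A z - (c : ℂ) • (z : H)) := by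
    rw [A.map_add, Submodule.coe_add, smul_add, hy]; abel
  have e2 : A (φ - z) - (c : ℂ) • ((φ - z : A.domain) : H) = y - (A z - (c : ℂ) • (z : H)) := by
    rw [A.map_sub, Submodule.coe_sub, smul_sub, hy]; abel
  have sym : (inner ℂ (φ : H) (A z - (c : ℂ) • (z : H))).re = (inner ℂ (z : H) y).re := by
    rw [← inner_conj_symm (z : H) y, Complex.conj_re, hy, inner_sub_left, inner_sub_right,
      hE.inner_symm, inner_smul_left, inner_smul_right, Complex.conj_ofReal]
  have hzin : (inner ℂ (z : H) y).re = 1 / c * ‖y‖ ^ 2 := by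
    rw [hzy, inner_smul_left, Complex.conj_ofReal, Complex.re_ofReal_mul]
    congr 1
    exact inner_self_eq_norm_sq (𝕜 := ℂ) y
  rw [e1, Submodule.coe_add, inner_add_left, inner_add_right (φ : H), inner_add_right (z : H)] at q1
  rw [e2, Submodule.coe_sub, inner_sub_left, inner_sub_right (φ : H) y,
    inner_sub_right (z : H) y] at q2
  simp only [Complex.add_re, Complex.sub_re, sym, hzin] at q1 q2
  have hsq : ‖y‖ ^ 2 ≤ (c * ‖(φ : H)‖) ^ 2 := by
    have h4 : 4 * (1 / c * ‖y‖ ^ 2) ≤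
        c * (2 * (‖(φ : H)‖ ^ 2 + (1 / c * ‖y‖) ^ 2)) := by
      rw [← hnz]
      have par' : ‖(φ : H) + z‖ ^ 2 + ‖(φ : H) - z‖ ^ 2 = 2 * (‖(φ : H)‖ ^ 2 + ‖(z : H)‖ ^ 2) := by
        simpa [sq] using par
      rw [← par']
      linarith
    have h5 : c * (2 * (‖(φ : H)‖ ^ 2 + (1 / c * ‖y‖) ^ 2)) =
        2 * c * ‖(φ : H)‖ ^ 2 + 2 * (1 / c * ‖y‖ ^ 2) := by
      field_simp
    have h6 : 1 / c * ‖y‖ ^ 2 ≤ c * ‖(φ : H)‖ ^ 2 := by linarith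
    calc ‖y‖ ^ 2 = c * (1 / c * ‖y‖ ^ 2) := by field_simp
      _ ≤ c * (c * ‖(φ : H)‖ ^ 2) := by gcongr
      _ = (c * ‖(φ : H)‖) ^ 2 := by ring
  exact le_of_sq_le_sq hsq (by positivity)

/-- Two spectral measures of the same operator have orthogonal values at `(-∞, -ε]` and `[0, 2c]`:
the powers of `A - c` grow at least like `(c + ε) ^ n` on the range of the first and at most like
`c ^ n` on the range of the second. -/
theorem proj_Iic_proj_Icc_eq_zero {F : PVM} (hF : IsSpectralMeasure A F) {ε c : ℝ} (hε : 0 < ε)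
    (hc : 0 < c) (ψ : H) : F.proj (Set.Iic (-ε)) (E.proj (Set.Icc 0 (2 * c)) ψ) = 0 := by
  have hm : MeasurableSet (Set.Icc 0 (2 * c)) := measurableSet_Icc
  have hJ : MeasurableSet (Set.Iic (-ε)) := measurableSet_Iic
  have grow : ∀ (n : ℕ) (x : H), E.proj (Set.Icc 0 (2 * c)) x = x →
      (c + ε) ^ n * ‖F.proj (Set.Iic (-ε)) x‖ ≤ c ^ n * ‖x‖ := by
    intro n
    induction n with
    | zero => intro x _; simpa using F.norm_proj_le hJ x
    | succ n ih =>
      intro x hx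
      have hxD : x ∈ A.domain := by rw [← hx]; exact hE.proj_Icc_mem_domain _ _ _
      set φ : A.domain := ⟨x, hxD⟩ with hφ
      have hfix : E.proj (Set.Icc 0 (2 * c)) (A φ - (c : ℂ) • x) = A φ - (c : ℂ) • x := by
        have h := hE.apply_proj hm φ
        have h' : (⟨E.proj (Set.Icc 0 (2 * c)) φ, hE.proj_mem_domain hm φ.2⟩ : A.domain) = φ :=
          Subtype.ext hx
        rw [h'] at h
        rw [map_sub, map_smul, ← h, hx]
      have h1 := ih _ hfix
      have h2 := hE.norm_sub_le hc φ hx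
      have h3 := hF.norm_sub_ge (ε := ε) (c := c)
        ⟨F.proj (Set.Iic (-ε)) x, hF.proj_mem_domain hJ hxD⟩ (by
          simp [F.proj_proj hJ hJ])
      rw [hF.apply_proj hJ φ] at h3
      rw [map_sub, map_smul] at h1
      calc (c + ε) ^ (n + 1) * ‖F.proj (Set.Iic (-ε)) x‖
          = (c + ε) ^ n * ((c + ε) * ‖F.proj (Set.Iic (-ε)) x‖) := by ring
        _ ≤ (c + ε) ^ n * ‖F.proj (Set.Iic (-ε)) (A φ) - (c : ℂ) • F.proj (Set.Iic (-ε)) x‖ := by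
            gcongr
        _ ≤ c ^ n * ‖A φ - (c : ℂ) • x‖ := h1
        _ ≤ c ^ n * (c * ‖x‖) := by gcongr
        _ = c ^ (n + 1) * ‖x‖ := by ring
  set x := E.proj (Set.Icc 0 (2 * c)) ψ
  have hx : E.proj (Set.Icc 0 (2 * c)) x = x := by
    simp [x, E.proj_proj hm hm]
  have hlim : Filter.Tendsto (fun n : ℕ => (c / (c + ε)) ^ n * ‖x‖) Filter.atTop (nhds (0 * ‖x‖)) :=
    (tendsto_pow_atTop_nhds_zero_of_lt_one (by positivity)
      ((div_lt_one (by positivity)).2 (by linarith))).mul_const _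
  rw [zero_mul] at hlim
  have hle : ‖F.proj (Set.Iic (-ε)) x‖ ≤ 0 := by
    refine ge_of_tendsto' hlim fun n => ?_
    have := grow n x hx
    rw [div_pow, div_mul_eq_mul_div, le_div_iff₀ (by positivity)]
    linarith
  exact norm_le_zero_iff.1 hle

theorem proj_Ici_proj_Iio_eq_zero {F : PVM} (hF : IsSpectralMeasure A F) (ψ : H) :
    E.proj (Set.Ici 0) (F.proj (Set.Iio 0) ψ) = 0 := by
  have hU : Set.Ici (0 : ℝ) = ⋃ n : ℕ, Set.Icc 0 (2 * ((n : ℝ) + 1)) := by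
    ext x
    simp only [Set.mem_Ici, Set.mem_iUnion, Set.mem_Icc]
    refine ⟨fun h => ?_, fun ⟨n, h⟩ => h.1⟩
    obtain ⟨n, hn⟩ := exists_nat_ge x
    exact ⟨n, h, by linarith [Nat.cast_nonneg (α := ℝ) n]⟩
  have hU' : Set.Iio (0 : ℝ) = ⋃ n : ℕ, Set.Iic (-(1 / ((n : ℝ) + 1))) := by
    ext x
    simp only [Set.mem_Iio, Set.mem_iUnion, Set.mem_Iic]
    constructor
    · intro h
      obtain ⟨n, hn⟩ := exists_nat_one_div_lt (neg_pos.2 h)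
      exact ⟨n, by linarith⟩
    · rintro ⟨n, h⟩
      have : 0 < 1 / ((n : ℝ) + 1) := by positivity
      linarith
  rw [hU]
  refine E.proj_iUnion_eq_zero (fun n => measurableSet_Icc) fun n => ?_
  -- move the projections to the other side of the inner product
  refine ext_inner_left ℂ fun χ => ?_
  rw [← E.inner_proj_left measurableSet_Icc, ← F.inner_proj_left measurableSet_Iio, hU',
    F.proj_iUnion_eq_zero (fun n => measurableSet_Iic) fun m =>
      hE.proj_Iic_proj_Icc_eq_zero hF (by positivity) (by positivity) χ]
  simp

/-- The value at `[0, ∞)` of a spectral measure is determined by the operator. -/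
theorem proj_Ici_unique {F : PVM} (hF : IsSpectralMeasure A F) :
    E.proj (Set.Ici 0) = F.proj (Set.Ici 0) := by
  have key : ∀ {E F : PVM}, IsSpectralMeasure A E → IsSpectralMeasure A F → ∀ ψ,
      E.proj (Set.Ici 0) (F.proj (Set.Ici 0) ψ) = E.proj (Set.Ici 0) ψ := by
    intro E F hE hF ψ
    conv_rhs => rw [← F.proj_add_proj_compl measurableSet_Ici (S := Set.Ici 0) ψ, map_add,
      Set.compl_Ici, hE.proj_Ici_proj_Iio_eq_zero hF, add_zero]
  ext1 ψ
  refine ext_inner_left ℂ fun χ => ?_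
  rw [← key hE hF ψ, ← E.inner_proj_left measurableSet_Ici, ← F.inner_proj_left measurableSet_Ici,
    key hF hE χ, F.inner_proj_left measurableSet_Ici]

theorem heaviside_eq : heaviside A = E.proj (Set.Ici 0) := by
  have h : ∃ E : PVM, IsSpectralMeasure A E := ⟨E, hE⟩
  rw [heaviside, dif_pos h]
  exact h.choose_spec.proj_Ici_unique hE

end IsSpectralMeasure

/-! ### Conjugation by unitary and anti-unitary operators -/

section Conjugation

variable {σ : ℂ →+* ℂ} [RingHomInvPair σ σ] [RingHomCompTriple σ σ (RingHom.id ℂ)]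

theorem re_of_id_or_conj (hσ : σ = RingHom.id ℂ ∨ σ = starRingEnd ℂ) (z : ℂ) :
    (σ z).re = z.re := by
  rcases hσ with rfl | rfl <;> simp

theorem ofReal_of_id_or_conj (hσ : σ = RingHom.id ℂ ∨ σ = starRingEnd ℂ) (r : ℝ) :
    σ (r : ℂ) = r := by
  rcases hσ with rfl | rfl <;> simp

theorem continuous_of_id_or_conj (hσ : σ = RingHom.id ℂ ∨ σ = starRingEnd ℂ) :
    Continuous σ := by
  rcases hσ with rfl | rfl
  · exact continuous_id
  · exact Complex.continuous_conj

theorem inner_map (hσ : σ = RingHom.id ℂ ∨ σ = starRingEnd ℂ) (U : H ≃ₛₗᵢ[σ] H) (φ ψ : H) :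
    inner ℂ (U φ) (U ψ) = σ (inner ℂ φ ψ) := by
  rcases hσ with rfl | rfl
  · exact LinearIsometryEquiv.inner_map_map (𝕜 := ℂ) U φ ψ
  · have e1 : U φ + (Complex.I : ℂ) • U ψ = U (φ - (Complex.I : ℂ) • ψ) := by
      rw [map_sub, map_smulₛₗ, Complex.conj_I, neg_smul, sub_neg_eq_add]
    have e2 : U φ - (Complex.I : ℂ) • U ψ = U (φ + (Complex.I : ℂ) • ψ) := by
      rw [map_add, map_smulₛₗ, Complex.conj_I, neg_smul, sub_eq_add_neg]
    have e3 : U φ + U ψ = U (φ + ψ) := (map_add U φ ψ).symm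
    have e4 : U φ - U ψ = U (φ - ψ) := (map_sub U φ ψ).symm
    rw [inner_eq_sum_norm_sq_div_four (U φ), inner_eq_sum_norm_sq_div_four φ, RCLike.I_to_complex,
      e1, e2, e3, e4, U.norm_map, U.norm_map, U.norm_map, U.norm_map]
    simp only [map_div₀, map_add, map_sub, map_mul, map_pow, Complex.conj_I,
      map_ofNat]
    simp only [Complex.coe_algebraMap, Complex.conj_ofReal]
    ring

theorem conj_symm_conj (U : H ≃ₛₗᵢ[σ] H) (T : H →L[ℂ] H) : conj U.symm (conj U T) = T := by
  ext1 ψ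
  simp [conj_apply]

theorem conj_conj_symm (U : H ≃ₛₗᵢ[σ] H) (T : H →L[ℂ] H) : conj U (conj U.symm T) = T := by
  ext1 ψ
  simp [conj_apply]

theorem conj_mul (U : H ≃ₛₗᵢ[σ] H) (S T : H →L[ℂ] H) : conj U (S * T) = conj U S * conj U T := by
  ext1 ψ
  simp [conj_apply]

theorem conj_sub (U : H ≃ₛₗᵢ[σ] H) (S T : H →L[ℂ] H) : conj U (S - T) = conj U S - conj U T := by
  ext1 ψ
  simp [conj_apply]

theorem conj_zero (U : H ≃ₛₗᵢ[σ] H) : conj U 0 = 0 := by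
  ext1 ψ
  simp [conj_apply]

theorem inner_conj_right (hσ : σ = RingHom.id ℂ ∨ σ = starRingEnd ℂ) (U : H ≃ₛₗᵢ[σ] H)
    (T : H →L[ℂ] H) (φ ψ : H) :
    inner ℂ φ (conj U T ψ) = σ (inner ℂ (U.symm φ) (T (U.symm ψ))) := by
  rw [← inner_map hσ, U.apply_symm_apply, conj_apply]

theorem inner_conj_left (hσ : σ = RingHom.id ℂ ∨ σ = starRingEnd ℂ) (U : H ≃ₛₗᵢ[σ] H)
    (T : H →L[ℂ] H) (φ ψ : H) :
    inner ℂ (conj U T φ) ψ = σ (inner ℂ (T (U.symm φ)) (U.symm ψ)) := by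
  rw [← inner_map hσ, U.apply_symm_apply, conj_apply]

theorem isSymmetric_conj (hσ : σ = RingHom.id ℂ ∨ σ = starRingEnd ℂ) (U : H ≃ₛₗᵢ[σ] H)
    {T : H →L[ℂ] H} (hT : (T : H →ₗ[ℂ] H).IsSymmetric) :
    (conj U T : H →ₗ[ℂ] H).IsSymmetric := by
  intro φ ψ
  have := hT (U.symm φ) (U.symm ψ)
  simp only [ContinuousLinearMap.coe_coe] at this ⊢
  rw [inner_conj_left hσ, inner_conj_right hσ, this]

theorem isStarProjection_conj (hσ : σ = RingHom.id ℂ ∨ σ = starRingEnd ℂ) (U : H ≃ₛₗᵢ[σ] H)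
    {T : H →L[ℂ] H} (hT : IsStarProjection T) : IsStarProjection (conj U T) := by
  refine ⟨?_, ?_⟩
  · rw [IsIdempotentElem, ← conj_mul, hT.isIdempotentElem.eq]
  · rw [ContinuousLinearMap.isSelfAdjoint_iff_isSymmetric]
    exact isSymmetric_conj hσ U
      (ContinuousLinearMap.isSelfAdjoint_iff_isSymmetric.1 hT.isSelfAdjoint)

theorem isPositive_conj (hσ : σ = RingHom.id ℂ ∨ σ = starRingEnd ℂ) (U : H ≃ₛₗᵢ[σ] H)
    {T : H →L[ℂ] H} (hT : T.IsPositive) : (conj U T).IsPositive := by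
  refine ⟨isSymmetric_conj hσ U hT.1, fun ψ => ?_⟩
  have := hT.2 (U.symm ψ)
  rw [ContinuousLinearMap.reApplyInnerSelf_apply] at this ⊢
  rw [inner_conj_left hσ]
  exact this.trans_eq (re_of_id_or_conj hσ _).symm

/-! ### Transport of the spectral measure -/

/-- The projection-valued measure `S ↦ U E(r⁻¹ S) U†`: if `E` is the spectral measure of `A`, it is
the one of `r U A U†`. -/
def PVM.conj (hσ : σ = RingHom.id ℂ ∨ σ = starRingEnd ℂ) (U : H ≃ₛₗᵢ[σ] H) (r : ℝ) (E : PVM) :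
    PVM where
  proj S := Projectile.conj U (E.proj ((fun t => r * t) ⁻¹' S))
  isStarProjection S hS :=
    isStarProjection_conj hσ U (E.isStarProjection _ (measurable_const_mul r hS))
  univ := by
    ext1 ψ
    simp [conj_apply, E.univ]
  inter S T hS hT := by
    rw [← conj_mul, Set.preimage_inter,
      E.inter _ _ (measurable_const_mul r hS) (measurable_const_mul r hT)]
  hasSum_iUnion S hS hd ψ := by
    have h := E.hasSum_iUnion (fun n => (fun t => r * t) ⁻¹' S n)
      (fun n => measurable_const_mul r (hS n)) (fun m n hmn => (hd hmn).preimage _) (U.symm ψ)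
    rw [← Set.preimage_iUnion] at h
    exact h.map U U.continuous

theorem PVM.diag_conj (hσ : σ = RingHom.id ℂ ∨ σ = starRingEnd ℂ) (U : H ≃ₛₗᵢ[σ] H) (r : ℝ)
    (E : PVM) (ψ : H) :
    (E.conj hσ U r).diag (U ψ) = (E.diag ψ).map (fun t => r * t) := by
  ext S hS
  rw [PVM.diag_apply _ _ hS, Measure.map_apply (measurable_const_mul r) hS,
    E.diag_apply _ (measurable_const_mul r hS)]
  simp [PVM.conj, conj_apply]

theorem IsSpectralMeasure.conj (hσ : σ = RingHom.id ℂ ∨ σ = starRingEnd ℂ) (U : H ≃ₛₗᵢ[σ] H)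
    {r : ℝ} (hr : r ≠ 0) {A B : H →ₗ.[ℂ] H}
    (hAB : ∀ ψ χ : H, (ψ, χ) ∈ A.graph ↔ (U ψ, (r : ℂ) • U χ) ∈ B.graph)
    {E : PVM} (hE : IsSpectralMeasure A E) : IsSpectralMeasure B (E.conj hσ U r) := by
  have hr' : (r : ℂ) ≠ 0 := Complex.ofReal_ne_zero.2 hr
  have hdom : ∀ ψ : H, U ψ ∈ B.domain ↔ ψ ∈ A.domain := by
    intro ψ
    rw [LinearPMap.mem_domain_iff, LinearPMap.mem_domain_iff]
    constructor
    · rintro ⟨η, hη⟩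
      refine ⟨U.symm ((r : ℂ)⁻¹ • η), (hAB _ _).2 ?_⟩
      rwa [U.apply_symm_apply, smul_inv_smul₀ hr']
    · rintro ⟨χ, hχ⟩
      exact ⟨_, (hAB _ _).1 hχ⟩
  refine ⟨fun φ => ?_, fun φ => ?_⟩
  · obtain ⟨ψ, rfl⟩ := U.surjective φ
    rw [hdom, hE.mem_domain_iff, PVM.diag_conj,
      integrable_map_measure (by fun_prop) (by fun_prop)]
    have : (fun t : ℝ => t ^ 2) ∘ (fun t => r * t) = fun t => r ^ 2 * t ^ 2 := by
      ext t; simp [mul_pow]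
    rw [this, integrable_const_mul_iff (IsUnit.mk0 _ (pow_ne_zero 2 hr))]
  · obtain ⟨φ, hφ⟩ := φ
    obtain ⟨ψ, rfl⟩ := U.surjective φ
    have hψ := (hdom ψ).1 hφ
    have hB : B ⟨U ψ, hφ⟩ = (r : ℂ) • U (A ⟨ψ, hψ⟩) := by
      have h1 := (hAB ψ (A ⟨ψ, hψ⟩)).1 (A.mem_graph ⟨ψ, hψ⟩)
      exact B.mem_graph_snd_inj (B.mem_graph ⟨U ψ, hφ⟩) h1 rfl
    have h2 := hE.inner_eq ⟨ψ, hψ⟩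
    simp only at h2 ⊢
    rw [hB, inner_smul_right, inner_map hσ, h2, ofReal_of_id_or_conj hσ, PVM.diag_conj,
      integral_map (by fun_prop) (by fun_prop), integral_const_mul, Complex.ofReal_mul]

/-- If `B = r U A U†` with `r > 0`, then `Θ(B) = U Θ(A) U†`. By uniqueness of the spectral measure
the choice made in `heaviside` is immaterial, and `A` has a spectral measure if and only if `B`
has one. -/
theorem conj_heaviside (hσ : σ = RingHom.id ℂ ∨ σ = starRingEnd ℂ) (U : H ≃ₛₗᵢ[σ] H)
    {r : ℝ} (hr : 0 < r) {A B : H →ₗ.[ℂ] H}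
    (hAB : ∀ ψ χ : H, (ψ, χ) ∈ A.graph ↔ (U ψ, (r : ℂ) • U χ) ∈ B.graph) :
    conj U (heaviside A) = heaviside B := by
  by_cases hA : ∃ E : PVM, IsSpectralMeasure A E
  · obtain ⟨E, hE⟩ := hA
    rw [hE.heaviside_eq, (hE.conj hσ U hr.ne' hAB).heaviside_eq]
    have : (fun t => r * t) ⁻¹' Set.Ici 0 = Set.Ici 0 := by
      ext t; simp [hr]
    simp [PVM.conj, this]
  · have hB : ¬ ∃ E : PVM, IsSpectralMeasure B E := by
      rintro ⟨F, hF⟩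
      refine hA ⟨_, hF.conj hσ U.symm (inv_ne_zero hr.ne') fun φ η => ?_⟩
      rw [hAB, map_smulₛₗ, ofReal_of_id_or_conj hσ, U.apply_symm_apply, U.apply_symm_apply,
        smul_smul, ← Complex.ofReal_mul, mul_inv_cancel₀ hr.ne', Complex.ofReal_one, one_smul]
    rw [heaviside, dif_neg hA, heaviside, dif_neg hB, conj_zero]

/-! ### Transport of traces, states and values -/

/-- The image of a Hilbert basis under a unitary or anti-unitary operator. -/
def mapHilbertBasis (hσ : σ = RingHom.id ℂ ∨ σ = starRingEnd ℂ) (U : H ≃ₛₗᵢ[σ] H) {ι : Type}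
    (e : HilbertBasis ι ℂ H) : HilbertBasis ι ℂ H :=
  HilbertBasis.mkOfOrthogonalEqBot (v := fun i => U (e i))
    (by
      classical
      rw [orthonormal_iff_ite]
      intro i j
      rw [inner_map hσ, orthonormal_iff_ite.1 e.orthonormal i j]
      split_ifs <;> simp)
    (by
      rw [Submodule.eq_bot_iff]
      intro ψ hψ
      have h : ∀ i, inner ℂ (e i) (U.symm ψ) = 0 := by
        intro i
        have h1 := hψ (U (e i)) (Submodule.subset_span ⟨i, rfl⟩)
        rw [← U.apply_symm_apply ψ, inner_map hσ] at h1
        simpa using h1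
      have h2 : e.repr (U.symm ψ) = 0 := by
        ext i
        rw [e.repr_apply_apply, h i]; rfl
      simpa using h2)

theorem mapHilbertBasis_apply (hσ : σ = RingHom.id ℂ ∨ σ = starRingEnd ℂ) (U : H ≃ₛₗᵢ[σ] H)
    {ι : Type} (e : HilbertBasis ι ℂ H) (i : ι) : mapHilbertBasis hσ U e i = U (e i) := by
  simp [mapHilbertBasis]

theorem HasTrace.conj (hσ : σ = RingHom.id ℂ ∨ σ = starRingEnd ℂ) (U : H ≃ₛₗᵢ[σ] H)
    {T : H →L[ℂ] H} {t : ℂ} (hT : HasTrace T t) : HasTrace (conj U T) (σ t) := by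
  intro ι e
  have h := hT ι (mapHilbertBasis hσ U.symm e)
  simp only [mapHilbertBasis_apply] at h
  simp only [inner_conj_right hσ]
  exact h.map σ (continuous_of_id_or_conj hσ)

theorem HasTrace.trace_eq {T : H →L[ℂ] H} {t : ℂ} (hT : HasTrace T t) : trace T = t := by
  have h : ∃ t : ℂ, HasTrace T t := ⟨t, hT⟩
  obtain ⟨w, e, -⟩ := exists_hilbertBasis ℂ H
  rw [trace, dif_pos h]
  exact (h.choose_spec w e).unique (hT w e)

theorem trace_conj (hσ : σ = RingHom.id ℂ ∨ σ = starRingEnd ℂ) (U : H ≃ₛₗᵢ[σ] H)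
    (T : H →L[ℂ] H) : trace (conj U T) = σ (trace T) := by
  by_cases h : ∃ t : ℂ, HasTrace T t
  · obtain ⟨t, ht⟩ := h
    rw [ht.trace_eq, (ht.conj hσ U).trace_eq]
  · have h' : ¬ ∃ t : ℂ, HasTrace (conj U T) t := by
      rintro ⟨t, ht⟩
      have := ht.conj hσ U.symm
      rw [conj_symm_conj] at this
      exact h ⟨_, this⟩
    rw [trace, dif_neg h', trace, dif_neg h, map_zero]

theorem conj_image_states (hσ : σ = RingHom.id ℂ ∨ σ = starRingEnd ℂ) (U : H ≃ₛₗᵢ[σ] H)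
    {R R' : Set ℝ} (hR : ∀ ψ : H, (∀ᵐ x : ℝ, x ∉ R → ψ x = 0) ↔ ∀ᵐ x : ℝ, x ∉ R' → U ψ x = 0) :
    conj U '' states R = states R' := by
  ext T
  constructor
  · rintro ⟨ρ, ⟨hpos, htr, hsupp⟩, rfl⟩
    refine ⟨isPositive_conj hσ U hpos, ?_, fun ψ => ?_⟩
    · have := htr.conj hσ U
      rwa [map_one] at this
    · exact (hR _).1 (hsupp (U.symm ψ))
  · rintro ⟨hpos, htr, hsupp⟩
    refine ⟨conj U.symm T, ⟨isPositive_conj hσ U.symm hpos, ?_, fun ψ => ?_⟩, conj_conj_symm U T⟩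
    · have := htr.conj hσ U.symm
      rwa [map_one] at this
    · rw [hR, conj_apply, U.apply_symm_apply]
      exact hsupp _

theorem values_eq_of_conj (hσ : σ = RingHom.id ℂ ∨ σ = starRingEnd ℂ) (U : H ≃ₛₗᵢ[σ] H)
    {R R' : Set ℝ} (hR : conj U '' states R = states R') {A B : H →L[ℂ] H} (hAB : conj U A = B) :
    values R' B = values R A := by
  have h : ∀ ρ, (trace (conj U ρ * B)).re = (trace (ρ * A)).re := fun ρ => by
    rw [← hAB, ← conj_mul, trace_conj hσ, re_of_id_or_conj hσ]
  ext v
  constructor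
  · rintro ⟨ρ', hρ', rfl⟩
    rw [← hR] at hρ'
    obtain ⟨ρ, hρ, rfl⟩ := hρ'
    exact ⟨ρ, hρ, h ρ⟩
  · rintro ⟨ρ, hρ, rfl⟩
    exact ⟨conj U ρ, hR ▸ ⟨ρ, hρ, rfl⟩, (h ρ).symm⟩

end Conjugation

/-! ### Boundedness and non-emptiness of the set of values -/

theorem exists_isSelfAdjoint_mul_self {K : Type*} [NormedAddCommGroup K] [InnerProductSpace ℂ K]
    [CompleteSpace K] {T : K →L[ℂ] K} (hT : T.IsPositive) :
    ∃ S : K →L[ℂ] K, IsSelfAdjoint S ∧ S * S = T := by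
  have h0 : 0 ≤ T := (ContinuousLinearMap.nonneg_iff_isPositive T).2 hT
  exact ⟨CFC.sqrt T, (CFC.sqrt_nonneg T).isSelfAdjoint, CFC.sqrt_mul_sqrt_self T h0⟩

theorem hasSum_sq_norm_inner {ι : Type} (e : HilbertBasis ι ℂ H) (ψ : H) :
    HasSum (fun i => ‖inner ℂ (e i) ψ‖ ^ 2) (‖ψ‖ ^ 2) := by
  have h := Complex.hasSum_re (e.hasSum_inner_mul_inner ψ ψ)
  have h1 : (inner ℂ ψ ψ).re = ‖ψ‖ ^ 2 := inner_self_eq_norm_sq (𝕜 := ℂ) ψ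
  rw [h1] at h
  convert h using 2 with i
  rw [← inner_conj_symm ψ (e i), Complex.conj_mul', ← Complex.ofReal_pow, Complex.ofReal_re]

theorem tsum_sq_norm_apply_adjoint {ι : Type} (e : HilbertBasis ι ℂ H) (B : H →L[ℂ] H) :
    ∑' i, ENNReal.ofReal (‖B (e i)‖ ^ 2) =
      ∑' i, ENNReal.ofReal (‖ContinuousLinearMap.adjoint B (e i)‖ ^ 2) := by
  have h : ∀ ψ : H, ENNReal.ofReal (‖ψ‖ ^ 2) =
      ∑' j, ENNReal.ofReal (‖inner ℂ (e j) ψ‖ ^ 2) := fun ψ => by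
    have := hasSum_sq_norm_inner e ψ
    rw [← this.tsum_eq, ENNReal.ofReal_tsum_of_nonneg (fun _ => by positivity) this.summable]
  simp_rw [h]
  rw [ENNReal.tsum_comm]
  refine tsum_congr fun i => tsum_congr fun j => ?_
  rw [ContinuousLinearMap.adjoint_inner_right, ← inner_conj_symm, RCLike.norm_conj]

/-- A density operator pairs boundedly with bounded operators: with `S = √ρ`, the diagonal elements
`⟨e, ρ A e⟩ = ⟨S e, S A e⟩` are dominated by the squares of two Hilbert–Schmidt operators. -/
theorem abs_re_trace_mul_le {ρ : H →L[ℂ] H} (hρ : ρ.IsPositive) (htr : HasTrace ρ 1)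
    (A : H →L[ℂ] H) : |(trace (ρ * A)).re| ≤ (1 + ‖A‖ ^ 2) / 2 := by
  by_cases h : ∃ t : ℂ, HasTrace (ρ * A) t
  swap
  -- `trace` is zero by convention if the product has no trace
  · rw [trace, dif_neg h]
    simp only [Complex.zero_re, abs_zero]
    positivity
  obtain ⟨t, ht⟩ := h
  rw [ht.trace_eq]
  obtain ⟨w, e, -⟩ := exists_hilbertBasis ℂ H
  obtain ⟨S, hS, hSS⟩ := exists_isSelfAdjoint_mul_self hρ
  have hSin : ∀ φ ψ : H, inner ℂ φ (ρ ψ) = inner ℂ (S φ) (S ψ) := fun φ ψ => by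
    have h1 : ContinuousLinearMap.adjoint S = S := hS
    rw [← hSS, ← ContinuousLinearMap.adjoint_inner_right, h1]; rfl
  have h1 : HasSum (fun i => ‖S (e i)‖ ^ 2) 1 := by
    have := Complex.hasSum_re (htr w e)
    simp only [hSin] at this
    rw [Complex.one_re] at this
    convert this using 2 with i
    exact (inner_self_eq_norm_sq (𝕜 := ℂ) (S (e i))).symm
  have h2 : ∑' i, ENNReal.ofReal (‖(S * A) (e i)‖ ^ 2) ≤ ENNReal.ofReal (‖A‖ ^ 2) := by
    rw [tsum_sq_norm_apply_adjoint]
    calc ∑' i, ENNReal.ofReal (‖ContinuousLinearMap.adjoint (S * A) (e i)‖ ^ 2)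
        ≤ ∑' i, ENNReal.ofReal (‖A‖ ^ 2) * ENNReal.ofReal (‖S (e i)‖ ^ 2) := by
          refine ENNReal.tsum_le_tsum fun i => ?_
          rw [← ENNReal.ofReal_mul (by positivity), ← mul_pow]
          refine ENNReal.ofReal_le_ofReal (pow_le_pow_left₀ (norm_nonneg _) ?_ 2)
          have h3 : ContinuousLinearMap.adjoint (S * A) =
              ContinuousLinearMap.adjoint A * S := by
            have h4 : star (S * A) = star A * star S := star_mul S A
            rwa [hS.star_eq] at h4
          rw [h3]
          refine ((ContinuousLinearMap.adjoint A).le_opNorm _).trans_eq ?_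
          rw [LinearIsometryEquiv.norm_map]; rfl
      _ = ENNReal.ofReal (‖A‖ ^ 2) := by
          rw [ENNReal.tsum_mul_left, ← ENNReal.ofReal_tsum_of_nonneg (fun _ => by positivity)
            h1.summable, h1.tsum_eq, ENNReal.ofReal_one, mul_one]
  have h3 : Summable fun i => ‖(S * A) (e i)‖ ^ 2 := by
    have := ENNReal.summable_toReal (ne_top_of_le_ne_top ENNReal.ofReal_ne_top h2)
    simpa [ENNReal.toReal_ofReal] using this
  have h4 : ∑' i, ‖(S * A) (e i)‖ ^ 2 ≤ ‖A‖ ^ 2 := by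
    rw [← ENNReal.ofReal_tsum_of_nonneg (fun _ => by positivity) h3] at h2
    exact (ENNReal.ofReal_le_ofReal_iff (by positivity)).1 h2
  have hsum := Complex.hasSum_re (ht w e)
  have hdom : ∀ i, |(inner ℂ (e i) ((ρ * A) (e i))).re| ≤
      (‖S (e i)‖ ^ 2 + ‖(S * A) (e i)‖ ^ 2) / 2 := by
    intro i
    have h5 : inner ℂ (e i) ((ρ * A) (e i)) = inner ℂ (S (e i)) ((S * A) (e i)) := hSin _ _
    rw [h5]
    have h6 := (Complex.abs_re_le_norm _).trans
      (norm_inner_le_norm (𝕜 := ℂ) (S (e i)) ((S * A) (e i)))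
    linarith [two_mul_le_add_sq ‖S (e i)‖ ‖(S * A) (e i)‖]
  have hD := (h1.add h3.hasSum).div_const 2
  have habs : |t.re| ≤ (1 + ∑' i, ‖(S * A) (e i)‖ ^ 2) / 2 := by
    rw [abs_le]
    constructor
    · exact hasSum_le (fun i => (abs_le.1 (hdom i)).1) hD.neg hsum
    · exact hasSum_le (fun i => (abs_le.1 (hdom i)).2) hsum hD
  linarith

theorem bddAbove_values (R : Set ℝ) (A : H →L[ℂ] H) : BddAbove (values R A) := by
  refine ⟨(1 + ‖A‖ ^ 2) / 2, ?_⟩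
  rintro v ⟨ρ, ⟨hpos, htr, -⟩, rfl⟩
  exact (le_abs_self _).trans (abs_re_trace_mul_le hpos htr A)

/-- The pure state of the uniform wave function on a set of finite positive measure. -/
theorem nonempty_states {R : Set ℝ} (hR : MeasurableSet R) (h0 : volume R ≠ 0)
    (hfin : volume R ≠ ⊤) : (states R).Nonempty := by
  set χ : H := indicatorConstLp 2 hR hfin (1 : ℂ) with hχ
  have hχ0 : χ ≠ 0 := by
    rw [← norm_ne_zero_iff, hχ, norm_indicatorConstLp (by norm_num) (by norm_num)]
    have : 0 < volume.real R := ENNReal.toReal_pos h0 hfin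
    simp only [norm_one, one_mul]
    positivity
  set ψ : H := ((‖χ‖⁻¹ : ℝ) : ℂ) • χ with hψ
  have hnorm : ‖ψ‖ = 1 := by
    rw [hψ, norm_smul, Complex.norm_real, norm_inv, norm_norm,
      inv_mul_cancel₀ (norm_ne_zero_iff.2 hχ0)]
  refine ⟨InnerProductSpace.rankOne ℂ ψ ψ, InnerProductSpace.isPositive_rankOne_self ψ, ?_, ?_⟩
  · intro ι e
    have h := e.hasSum_inner_mul_inner ψ ψ
    rw [inner_self_eq_norm_sq_to_K, hnorm] at h
    simpa [InnerProductSpace.rankOne_apply, inner_smul_right] using h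
  · intro φ
    have h1 : InnerProductSpace.rankOne ℂ ψ ψ φ =
        (inner ℂ ψ φ * ((‖χ‖⁻¹ : ℝ) : ℂ)) • χ := by
      rw [InnerProductSpace.rankOne_apply, mul_smul]
    rw [h1]
    filter_upwards [Lp.coeFn_smul (inner ℂ ψ φ * ((‖χ‖⁻¹ : ℝ) : ℂ)) χ,
      indicatorConstLp_coeFn_notMem (p := 2) (hs := hR) (hμs := hfin) (c := (1 : ℂ))]
      with x hx1 hx2 hxR
    rw [hx1, Pi.smul_apply, hχ, hx2 hxR, smul_zero]

/-! ### Weighted affine substitutions on `L²` -/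

theorem map_affine_volume {s : ℝ} (hs : s ≠ 0) (d : ℝ) :
    Measure.map (fun x : ℝ => s * x + d) volume = ENNReal.ofReal |s⁻¹| • volume := by
  have h : (fun x : ℝ => s * x + d) = (fun x => x + d) ∘ (fun x => s * x) := rfl
  rw [h, ← Measure.map_map (by fun_prop) (by fun_prop), Real.map_volume_mul_left hs,
    Measure.map_smul, map_add_right_eq_self]

theorem quasiMeasurePreserving_affine {s : ℝ} (hs : s ≠ 0) (d : ℝ) :
    Measure.QuasiMeasurePreserving (fun x : ℝ => s * x + d) volume volume := by
  refine ⟨by fun_prop, ?_⟩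
  rw [map_affine_volume hs]
  exact Measure.smul_absolutelyContinuous

section Weighted

variable {σ : ℂ →+* ℂ} [RingHomInvPair σ σ] [RingHomCompTriple σ σ (RingHom.id ℂ)]

theorem norm_of_id_or_conj (hσ : σ = RingHom.id ℂ ∨ σ = starRingEnd ℂ) (z : ℂ) :
    ‖σ z‖ = ‖z‖ := by
  rcases hσ with rfl | rfl <;> simp

theorem aestronglyMeasurable_weighted (hσ : σ = RingHom.id ℂ ∨ σ = starRingEnd ℂ) {s : ℝ}
    (hs : s ≠ 0) (d : ℝ) {c : ℝ → ℂ} (hc : Measurable c) (f : H) :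
    AEStronglyMeasurable (fun x => c x * σ (f (s * x + d))) (volume : Measure ℝ) :=
  hc.aestronglyMeasurable.mul ((continuous_of_id_or_conj hσ).comp_aestronglyMeasurable
    ((Lp.aestronglyMeasurable f).comp_quasiMeasurePreserving (quasiMeasurePreserving_affine hs d)))

theorem eLpNorm_weighted (hσ : σ = RingHom.id ℂ ∨ σ = starRingEnd ℂ) {s : ℝ} (hs : s ≠ 0) (d : ℝ)
    {c : ℝ → ℂ} (hc' : ∀ x, ‖c x‖ = √|s|) (f : H) :
    eLpNorm (fun x => c x * σ (f (s * x + d))) 2 volume = eLpNorm f 2 volume := by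
  have h1 : eLpNorm (fun x => c x * σ (f (s * x + d))) 2 volume =
      eLpNorm ((√|s|) • ((f : ℝ → ℂ) ∘ fun x => s * x + d)) 2 volume := by
    refine eLpNorm_congr_norm_ae (ae_of_all _ fun x => ?_)
    simp [hc', norm_of_id_or_conj hσ, abs_of_nonneg (Real.sqrt_nonneg |s|)]
  have hf : AEStronglyMeasurable f (Measure.map (fun x : ℝ => s * x + d) volume) := by
    rw [map_affine_volume hs]
    exact (Lp.aestronglyMeasurable f).smul_measure _
  have hpos : 0 < |s| := abs_pos.2 hs
  rw [h1, eLpNorm_const_smul, ← eLpNorm_map_measure hf (by fun_prop), map_affine_volume hs,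
    eLpNorm_smul_measure_of_ne_top (by norm_num), smul_eq_mul, ← mul_assoc]
  have h2 : ‖√|s|‖ₑ * ENNReal.ofReal |s⁻¹| ^ (1 / (2 : ℝ≥0∞)).toReal = 1 := by
    rw [Real.enorm_eq_ofReal (by positivity), ENNReal.ofReal_rpow_of_nonneg (by positivity)
      (by positivity), ← ENNReal.ofReal_mul (by positivity), abs_inv]
    have h3 : (1 / (2 : ℝ≥0∞)).toReal = 1 / 2 := by simp
    rw [h3, ← Real.sqrt_eq_rpow, Real.sqrt_inv, mul_inv_cancel₀ (by positivity),
      ENNReal.ofReal_one]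
  rw [h2, one_mul]

theorem memLp_weighted (hσ : σ = RingHom.id ℂ ∨ σ = starRingEnd ℂ) {s : ℝ} (hs : s ≠ 0) (d : ℝ)
    {c : ℝ → ℂ} (hc : Measurable c) (hc' : ∀ x, ‖c x‖ = √|s|) (f : H) :
    MemLp (fun x => c x * σ (f (s * x + d))) 2 (volume : Measure ℝ) :=
  ⟨aestronglyMeasurable_weighted hσ hs d hc f, by
    rw [eLpNorm_weighted hσ hs d hc']; exact Lp.eLpNorm_lt_top f⟩

/-- The isometry `(W f)(x) = c(x) σ(f(s x + d))` of `L²`, for `|c| = √|s|`; it is linear if `σ` is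
the identity and antilinear if `σ` is complex conjugation. -/
def weightedComp (hσ : σ = RingHom.id ℂ ∨ σ = starRingEnd ℂ) {s : ℝ} (hs : s ≠ 0) (d : ℝ)
    {c : ℝ → ℂ} (hc : Measurable c) (hc' : ∀ x, ‖c x‖ = √|s|) : H →ₛₗᵢ[σ] H where
  toFun f := (memLp_weighted hσ hs d hc hc' f).toLp _
  map_add' f g := by
    rw [← MemLp.toLp_add, MemLp.toLp_eq_toLp_iff]
    filter_upwards [(quasiMeasurePreserving_affine hs d).ae (Lp.coeFn_add f g)] with x hx
    change c x * σ ((f + g : H) (s * x + d)) =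
      c x * σ (f (s * x + d)) + c x * σ (g (s * x + d))
    rw [hx, Pi.add_apply, map_add, mul_add]
  map_smul' a f := by
    rw [← MemLp.toLp_const_smul, MemLp.toLp_eq_toLp_iff]
    filter_upwards [(quasiMeasurePreserving_affine hs d).ae (Lp.coeFn_smul a f)] with x hx
    simp [hx, mul_left_comm]
  norm_map' f := by
    simp only [LinearMap.coe_mk, AddHom.coe_mk]
    rw [Lp.norm_toLp, eLpNorm_weighted hσ hs d hc', Lp.norm_def]

theorem weightedComp_coeFn (hσ : σ = RingHom.id ℂ ∨ σ = starRingEnd ℂ) {s : ℝ} (hs : s ≠ 0) (d : ℝ)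
    {c : ℝ → ℂ} (hc : Measurable c) (hc' : ∀ x, ‖c x‖ = √|s|) (f : H) :
    ∀ᵐ x : ℝ, weightedComp hσ hs d hc hc' f x = c x * σ (f (s * x + d)) :=
  MemLp.coeFn_toLp (memLp_weighted hσ hs d hc hc' f)

theorem weightedComp_surjective (hσ : σ = RingHom.id ℂ ∨ σ = starRingEnd ℂ) {s : ℝ} (hs : s ≠ 0)
    (d : ℝ) {c : ℝ → ℂ} (hc : Measurable c) (hc' : ∀ x, ‖c x‖ = √|s|) :
    Function.Surjective (weightedComp hσ hs d hc hc') := by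
  intro g
  have hs' : s⁻¹ ≠ 0 := inv_ne_zero hs
  -- the inverse is the weighted substitution along the inverse affine map
  have hm : Measurable fun y => σ (c (s⁻¹ * y + -(s⁻¹ * d)))⁻¹ :=
    (continuous_of_id_or_conj hσ).measurable.comp (hc.comp (by fun_prop)).inv
  have hn : ∀ y, ‖σ (c (s⁻¹ * y + -(s⁻¹ * d)))⁻¹‖ = √|s⁻¹| := fun y => by
    rw [norm_of_id_or_conj hσ, norm_inv, hc', abs_inv, Real.sqrt_inv]
  refine ⟨weightedComp hσ hs' (-(s⁻¹ * d)) hm hn g, ?_⟩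
  refine Lp.ext ?_
  filter_upwards [weightedComp_coeFn hσ hs d hc hc' (weightedComp hσ hs' (-(s⁻¹ * d)) hm hn g),
    (quasiMeasurePreserving_affine hs d).ae
      (weightedComp_coeFn hσ hs' (-(s⁻¹ * d)) hm hn g)] with x h1 h2
  have hx : s⁻¹ * (s * x + d) + -(s⁻¹ * d) = x := by field_simp; ring
  have hcx : c x ≠ 0 := by
    rw [← norm_ne_zero_iff, hc']
    have := abs_pos.2 hs
    positivity
  rw [h1, h2, hx, map_mul, RingHomInvPair.comp_apply_eq, RingHomInvPair.comp_apply_eq,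
    mul_inv_cancel_left₀ hcx]

/-- `weightedComp` as a unitary or anti-unitary operator. -/
def weightedEquiv (hσ : σ = RingHom.id ℂ ∨ σ = starRingEnd ℂ) {s : ℝ} (hs : s ≠ 0) (d : ℝ)
    {c : ℝ → ℂ} (hc : Measurable c) (hc' : ∀ x, ‖c x‖ = √|s|) : H ≃ₛₗᵢ[σ] H :=
  LinearIsometryEquiv.ofSurjective (weightedComp hσ hs d hc hc')
    (weightedComp_surjective hσ hs d hc hc')

theorem weightedEquiv_coeFn (hσ : σ = RingHom.id ℂ ∨ σ = starRingEnd ℂ) {s : ℝ} (hs : s ≠ 0)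
    (d : ℝ) {c : ℝ → ℂ} (hc : Measurable c) (hc' : ∀ x, ‖c x‖ = √|s|) (f : H) :
    ∀ᵐ x : ℝ, weightedEquiv hσ hs d hc hc' f x = c x * σ (f (s * x + d)) :=
  weightedComp_coeFn hσ hs d hc hc' f

theorem weightedEquiv_support (hσ : σ = RingHom.id ℂ ∨ σ = starRingEnd ℂ) {s : ℝ} (hs : s ≠ 0)
    (d : ℝ) {c : ℝ → ℂ} (hc : Measurable c) (hc' : ∀ x, ‖c x‖ = √|s|) {R R' : Set ℝ}
    (hR : ∀ x, x ∈ R' ↔ s * x + d ∈ R) (f : H) :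
    (∀ᵐ x : ℝ, x ∉ R → f x = 0) ↔
      ∀ᵐ x : ℝ, x ∉ R' → weightedEquiv hσ hs d hc hc' f x = 0 := by
  have hcx : ∀ x, c x ≠ 0 := fun x => by
    rw [← norm_ne_zero_iff, hc']
    have := abs_pos.2 hs
    positivity
  constructor
  · intro h
    filter_upwards [(quasiMeasurePreserving_affine hs d).ae h,
      weightedEquiv_coeFn hσ hs d hc hc' f] with x h1 h2 hx
    rw [h2, h1 (fun h3 => hx ((hR x).2 h3)), map_zero, mul_zero]
  · intro h
    have h' : ∀ᵐ x : ℝ, x ∉ R' → f (s * x + d) = 0 := by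
      filter_upwards [h, weightedEquiv_coeFn hσ hs d hc hc' f] with x h1 h2 hx
      have h3 := h1 hx
      rw [h2, mul_eq_zero, or_iff_right (hcx x)] at h3
      rwa [map_eq_zero] at h3
    filter_upwards [(quasiMeasurePreserving_affine (inv_ne_zero hs) (-(s⁻¹ * d))).ae h']
      with y h1 hy
    have hy' : s * (s⁻¹ * y + -(s⁻¹ * d)) + d = y := by field_simp; ring
    rw [hy'] at h1
    exact h1 (fun h3 => hy (by rwa [hR, hy'] at h3))

end Weighted

/-! ### The cores of the operators `a X + b P + c` -/

theorem phaseS_apply (a b c : ℝ) (f : 𝓢(ℝ, ℂ)) (x : ℝ) :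
    phaseS a b c f x = a * (x * f x) + b * (-Complex.I * deriv f x) + c * f x := by
  simp [phaseS, positionS_apply, momentumS_apply]

theorem schwartzToH_coeFn (f : 𝓢(ℝ, ℂ)) : ∀ᵐ x : ℝ, schwartzToH f x = f x :=
  SchwartzMap.coeFn_toLp f 2 volume

theorem dense_range_schwartzToH : Dense (LinearMap.range schwartzToH : Set H) :=
  SchwartzMap.denseRange_toLpCLM (E := ℝ) (F := ℂ) (p := 2) (μ := volume) (by norm_num)

theorem phaseOpCore_apply (a b c : ℝ) (f : 𝓢(ℝ, ℂ))
    (hf : schwartzToH f ∈ (phaseOpCore a b c).domain) :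
    phaseOpCore a b c ⟨schwartzToH f, hf⟩ = schwartzToH (phaseS a b c f) := by
  have h : (LinearEquiv.ofInjective schwartzToH schwartzToH_injective).symm ⟨schwartzToH f, hf⟩ =
      f := by
    rw [LinearEquiv.symm_apply_eq]; rfl
  change schwartzToH (phaseS a b c
    ((LinearEquiv.ofInjective schwartzToH schwartzToH_injective).symm ⟨schwartzToH f, hf⟩)) = _
  rw [h]

theorem mem_graph_phaseOpCore_iff (a b c : ℝ) (ψ χ : H) :
    (ψ, χ) ∈ (phaseOpCore a b c).graph ↔
      ∃ f : 𝓢(ℝ, ℂ), schwartzToH f = ψ ∧ schwartzToH (phaseS a b c f) = χ := by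
  rw [LinearPMap.mem_graph_iff]
  constructor
  · rintro ⟨⟨_, f, rfl⟩, rfl, rfl⟩
    exact ⟨f, rfl, (phaseOpCore_apply a b c f ⟨f, rfl⟩).symm⟩
  · rintro ⟨f, rfl, rfl⟩
    exact ⟨⟨schwartzToH f, f, rfl⟩, rfl, phaseOpCore_apply a b c f ⟨f, rfl⟩⟩

theorem inner_schwartzToH (f g : 𝓢(ℝ, ℂ)) :
    inner ℂ (schwartzToH f) (schwartzToH g) = ∫ x : ℝ, starRingEnd ℂ (f x) * g x := by
  have h := SchwartzMap.inner_toL2_toL2_eq f g (volume : Measure ℝ)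
  refine (h : inner ℂ (schwartzToH f) (schwartzToH g) = _).trans ?_
  simp [mul_comm]

theorem inner_positionS (f g : 𝓢(ℝ, ℂ)) :
    inner ℂ (schwartzToH (positionS f)) (schwartzToH g) =
      inner ℂ (schwartzToH f) (schwartzToH (positionS g)) := by
  rw [inner_schwartzToH, inner_schwartzToH]
  refine integral_congr_ae (ae_of_all _ fun x => ?_)
  simp only [positionS_apply, map_mul, Complex.conj_ofReal]
  ring

theorem inner_momentumS (f g : 𝓢(ℝ, ℂ)) :
    inner ℂ (schwartzToH (momentumS f)) (schwartzToH g) =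
      inner ℂ (schwartzToH f) (schwartzToH (momentumS g)) := by
  set fbar : 𝓢(ℝ, ℂ) := f.postcompCLM (𝕜 := ℝ) (Complex.conjCLE : ℂ →L[ℝ] ℂ) with hfbar
  have h1 : ∀ x, fbar x = starRingEnd ℂ (f x) := fun x => rfl
  have h2 : ∀ x, deriv fbar x = starRingEnd ℂ (deriv f x) := fun x =>
    ((f.hasDerivAt x).star).deriv
  have h := SchwartzMap.integral_mul_deriv_eq_neg_deriv_mul fbar g
  simp only [h1, h2] at h
  rw [inner_schwartzToH, inner_schwartzToH]
  simp only [momentumS_apply, map_mul, map_neg, Complex.conj_I, neg_neg, mul_assoc,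
    mul_left_comm _ (-Complex.I)]
  rw [integral_const_mul, integral_const_mul, h]
  ring

theorem inner_phaseS (a b c : ℝ) (f g : 𝓢(ℝ, ℂ)) :
    inner ℂ (schwartzToH (phaseS a b c f)) (schwartzToH g) =
      inner ℂ (schwartzToH f) (schwartzToH (phaseS a b c g)) := by
  simp only [phaseS, LinearMap.add_apply, LinearMap.smul_apply, LinearMap.id_apply, map_add,
    map_smul, inner_add_left, inner_add_right, inner_smul_left, inner_smul_right,
    Complex.conj_ofReal, inner_positionS, inner_momentumS]

/-- The core is symmetric and densely defined, hence contained in its closed adjoint. -/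
theorem isClosable_phaseOpCore (a b c : ℝ) : (phaseOpCore a b c).IsClosable := by
  have hd : Dense ((phaseOpCore a b c).domain : Set H) := dense_range_schwartzToH
  have hs : (phaseOpCore a b c).IsFormalAdjoint (phaseOpCore a b c) := by
    rintro ⟨_, f, rfl⟩ ⟨_, g, rfl⟩
    have h1 := phaseOpCore_apply a b c f ⟨f, rfl⟩
    have h2 := phaseOpCore_apply a b c g ⟨g, rfl⟩
    have h3 := inner_phaseS a b c f g
    rw [← h1, ← h2] at h3
    exact h3
  exact (LinearPMap.adjoint_isClosed hd).isClosable.leIsClosable (hs.le_adjoint hd)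

/-- A unitary or anti-unitary operator that preserves the Schwartz space and intertwines, up to a
factor `r`, two operators of the form `a X + b P + c` there also intertwines their closures. -/
theorem mem_graph_phaseOp_iff {σ : ℂ →+* ℂ} [RingHomInvPair σ σ] (U : H ≃ₛₗᵢ[σ] H)
    {r : ℝ} (hr : r ≠ 0) {a b c a' b' c' : ℝ} (u : 𝓢(ℝ, ℂ) → 𝓢(ℝ, ℂ))
    (hu : Function.Surjective u) (hU : ∀ f, U (schwartzToH f) = schwartzToH (u f))
    (hcomm : ∀ f, (r : ℂ) • u (phaseS a b c f) = phaseS a' b' c' (u f)) (ψ χ : H) :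
    (ψ, χ) ∈ (phaseOp a b c).graph ↔ (U ψ, (r : ℂ) • U χ) ∈ (phaseOp a' b' c').graph := by
  have hr' : (r : ℂ) ≠ 0 := Complex.ofReal_ne_zero.2 hr
  have core : ∀ ψ χ : H, (ψ, χ) ∈ (phaseOpCore a b c).graph ↔
      (U ψ, (r : ℂ) • U χ) ∈ (phaseOpCore a' b' c').graph := by
    intro ψ χ
    simp only [mem_graph_phaseOpCore_iff]
    constructor
    · rintro ⟨f, rfl, rfl⟩
      exact ⟨u f, (hU f).symm, by rw [← hcomm, map_smul, hU]⟩
    · rintro ⟨g, h1, h2⟩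
      obtain ⟨f, rfl⟩ := hu g
      refine ⟨f, U.injective (by rw [hU, h1]), U.injective (smul_right_injective H hr' ?_)⟩
      simp only [hU]
      rw [← h2, ← hcomm, map_smul]
  let Φ : H × H ≃ₜ H × H :=
    U.toHomeomorph.prodCongr (U.toHomeomorph.trans (Homeomorph.smulOfNeZero (r : ℂ) hr'))
  have hΦ : ∀ p : H × H, Φ p = (U p.1, (r : ℂ) • U p.2) := fun p => rfl
  have hpre : Φ ⁻¹' ((phaseOpCore a' b' c').graph : Set (H × H)) = (phaseOpCore a b c).graph := by
    ext p
    exact (core p.1 p.2).symm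
  rw [phaseOp, phaseOp, ← (isClosable_phaseOpCore a b c).graph_closure_eq_closure_graph,
    ← (isClosable_phaseOpCore a' b' c').graph_closure_eq_closure_graph, ← SetLike.mem_coe,
    ← SetLike.mem_coe, Submodule.topologicalClosure_coe, Submodule.topologicalClosure_coe,
    ← hpre, ← Φ.preimage_closure]
  rfl

/-! ### Chirps and metaplectic operators -/

/-- The phase factor `exp(i (k x + m x² / 2))`. -/
def chirp (k m x : ℝ) : ℂ := Complex.exp (((k * x + m * x ^ 2 / 2 : ℝ) : ℂ) * Complex.I)

theorem norm_chirp (k m x : ℝ) : ‖chirp k m x‖ = 1 := Complex.norm_exp_ofReal_mul_I _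

theorem continuous_chirp (k m : ℝ) : Continuous (chirp k m) := by
  unfold chirp; fun_prop

theorem chirp_mul_chirp_neg (k m x : ℝ) : chirp k m x * chirp (-k) (-m) x = 1 := by
  rw [chirp, chirp, ← Complex.exp_add, ← add_mul, ← Complex.ofReal_add]
  have : k * x + m * x ^ 2 / 2 + (-k * x + -m * x ^ 2 / 2) = 0 := by ring
  rw [this, Complex.ofReal_zero, zero_mul, Complex.exp_zero]

theorem hasDerivAt_chirp (k m x : ℝ) :
    HasDerivAt (chirp k m) (Complex.I * (k + m * x) * chirp k m x) x := by
  have h1 : HasDerivAt (fun x : ℝ => k * x + m * x ^ 2 / 2) (k + m * x) x := by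
    have := ((hasDerivAt_id x).const_mul k).add (((hasDerivAt_pow 2 x).const_mul m).div_const 2)
    refine this.congr_deriv ?_
    simp; ring
  have h2 := (h1.ofReal_comp.mul_const Complex.I).cexp
  refine h2.congr_deriv ?_
  rw [chirp]; push_cast; ring

theorem hasTemperateGrowth_exp_mul_I :
    Function.HasTemperateGrowth (fun t : ℝ => Complex.exp ((t : ℂ) * Complex.I)) := by
  have hder : ∀ n : ℕ, iteratedDeriv n (fun t : ℝ => Complex.exp ((t : ℂ) * Complex.I)) =
      fun t : ℝ => Complex.I ^ n * Complex.exp ((t : ℂ) * Complex.I) := by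
    intro n
    induction n with
    | zero => simp
    | succ n ih =>
      rw [iteratedDeriv_succ, ih]
      ext t
      have h := (((hasDerivAt_id t).ofReal_comp.mul_const Complex.I).cexp).const_mul (Complex.I ^ n)
      refine h.deriv.trans ?_
      simp [pow_succ]; ring
  refine ⟨(Complex.ofRealCLM.contDiff.mul contDiff_const).cexp, fun n => ⟨0, 1, fun t => ?_⟩⟩
  rw [norm_iteratedFDeriv_eq_norm_iteratedDeriv, hder]
  simp [Complex.norm_exp_ofReal_mul_I]

theorem hasTemperateGrowth_chirp (k m : ℝ) : Function.HasTemperateGrowth (chirp k m) := by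
  have hid : Function.HasTemperateGrowth (fun x : ℝ => x) := .id'
  have hq : Function.HasTemperateGrowth (fun x : ℝ => k * x + m / 2 * x ^ 2) :=
    ((Function.HasTemperateGrowth.const k).mul hid).add
      ((Function.HasTemperateGrowth.const (m / 2)).mul (hid.pow 2))
  have h : chirp k m = (fun t : ℝ => Complex.exp ((t : ℂ) * Complex.I)) ∘
      fun x : ℝ => k * x + m / 2 * x ^ 2 := by
    ext x
    simp only [chirp, Function.comp]
    congr 3; ring
  rw [h]
  exact hasTemperateGrowth_exp_mul_I.comp hq

theorem hasTemperateGrowth_affine (s d : ℝ) :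
    Function.HasTemperateGrowth (fun x : ℝ => s * x + d) :=
  ((Function.HasTemperateGrowth.const s).mul .id').add (.const d)

section Metaplectic

variable {σ : ℂ →+* ℂ} [RingHomInvPair σ σ] [RingHomCompTriple σ σ (RingHom.id ℂ)]

theorem exists_schwartz_weighted (hσ : σ = RingHom.id ℂ ∨ σ = starRingEnd ℂ) {s : ℝ} (hs : s ≠ 0)
    (d : ℝ) {c : ℝ → ℂ} (hc : c.HasTemperateGrowth) (f : 𝓢(ℝ, ℂ)) :
    ∃ g : 𝓢(ℝ, ℂ), ∀ x, g x = c x * σ (f (s * x + d)) := by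
  obtain ⟨f', hf'⟩ : ∃ f' : 𝓢(ℝ, ℂ), ∀ x, f' x = σ (f x) := by
    rcases hσ with rfl | rfl
    · exact ⟨f, fun x => rfl⟩
    · exact ⟨f.postcompCLM (𝕜 := ℝ) (Complex.conjCLE : ℂ →L[ℝ] ℂ), fun x => rfl⟩
  have hgrow : ∃ (k : ℕ) (C : ℝ), ∀ x : ℝ, ‖x‖ ≤ C * (1 + ‖s * x + d‖) ^ k := by
    refine ⟨1, |s|⁻¹ * (1 + |d|), fun x => ?_⟩
    have hpos : 0 < |s| := abs_pos.2 hs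
    rw [pow_one, Real.norm_eq_abs, Real.norm_eq_abs, mul_assoc, ← div_eq_inv_mul,
      le_div_iff₀ hpos, mul_comm |x|, ← abs_mul]
    have h1 : |s * x| ≤ |s * x + d| + |d| := by
      simpa using abs_sub (s * x + d) d
    nlinarith [abs_nonneg (s * x + d), abs_nonneg d,
      mul_nonneg (abs_nonneg (s * x + d)) (abs_nonneg d)]
  refine ⟨SchwartzMap.smulLeftCLM ℂ c
    (SchwartzMap.compCLM ℂ (hasTemperateGrowth_affine s d) hgrow f'), fun x => ?_⟩
  rw [SchwartzMap.smulLeftCLM_apply_apply hc, SchwartzMap.compCLM_apply]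
  simp [hf']

theorem hasDerivAt_of_id_or_conj (hσ : σ = RingHom.id ℂ ∨ σ = starRingEnd ℂ) {f : ℝ → ℂ} {f' : ℂ}
    {x : ℝ} (hf : HasDerivAt f f' x) : HasDerivAt (fun x => σ (f x)) (σ f') x := by
  rcases hσ with rfl | rfl
  · exact hf
  · exact hf.star

theorem hasTemperateGrowth_of_id_or_conj (hσ : σ = RingHom.id ℂ ∨ σ = starRingEnd ℂ) {f : ℝ → ℂ}
    (hf : f.HasTemperateGrowth) : Function.HasTemperateGrowth fun x => σ (f x) := by
  rcases hσ with rfl | rfl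
  · exact hf
  · exact (Complex.conjCLE : ℂ →L[ℝ] ℂ).hasTemperateGrowth.comp hf

theorem measurable_metaplectic_weight (s k m : ℝ) :
    Measurable fun x => ((√|s| : ℝ) : ℂ) * chirp k m x :=
  ((continuous_chirp k m).const_mul _).measurable

theorem norm_metaplectic_weight (s k m x : ℝ) :
    ‖((√|s| : ℝ) : ℂ) * chirp k m x‖ = √|s| := by
  rw [norm_mul, norm_chirp, mul_one, Complex.norm_real, Real.norm_of_nonneg (by positivity)]

/-- The metaplectic operator `(W f)(x) = √|s| exp(i (k x + m x² / 2)) σ(f(s x + d))`; it is unitary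
if `σ` is the identity and anti-unitary if `σ` is complex conjugation. -/
def metaplectic (hσ : σ = RingHom.id ℂ ∨ σ = starRingEnd ℂ) {s : ℝ} (hs : s ≠ 0) (d k m : ℝ) :
    H ≃ₛₗᵢ[σ] H :=
  weightedEquiv hσ hs d (measurable_metaplectic_weight s k m) (norm_metaplectic_weight s k m)

/-- Metaplectic operators act on the operators `a X + b P + c` by affine transformations of the
phase plane. The sign `ε` is that of `σ(i) = ε i`. -/
theorem metaplectic_mem_graph_iff (hσ : σ = RingHom.id ℂ ∨ σ = starRingEnd ℂ) {ε : ℝ}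
    (hε : σ Complex.I = ε * Complex.I) {s : ℝ} (hs : s ≠ 0) {d k m r : ℝ} (hr : r ≠ 0)
    {a b c a' b' c' : ℝ} (ha : r * (a * s) = a' + b' * m) (hb : r * (ε * b) = b' * s)
    (hc : r * (a * d + c) = b' * k + c') (ψ χ : H) :
    (ψ, χ) ∈ (phaseOp a b c).graph ↔
      (metaplectic hσ hs d k m ψ, (r : ℂ) • metaplectic hσ hs d k m χ) ∈
        (phaseOp a' b' c').graph := by
  have htg : Function.HasTemperateGrowth fun x => ((√|s| : ℝ) : ℂ) * chirp k m x :=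
    (Function.HasTemperateGrowth.const _).mul (hasTemperateGrowth_chirp k m)
  choose u hu using fun f : 𝓢(ℝ, ℂ) => exists_schwartz_weighted hσ hs d htg f
  have hs0 : ((√|s| : ℝ) : ℂ) ≠ 0 := by
    have := abs_pos.2 hs
    exact Complex.ofReal_ne_zero.2 (by positivity)
  refine mem_graph_phaseOp_iff _ hr u ?_ ?_ ?_ ψ χ
  · intro g
    have htg' : Function.HasTemperateGrowth fun y =>
        σ (((√|s| : ℝ) : ℂ)⁻¹ * chirp (-k) (-m) (s⁻¹ * y + -(s⁻¹ * d))) :=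
      hasTemperateGrowth_of_id_or_conj hσ ((Function.HasTemperateGrowth.const _).mul
        ((hasTemperateGrowth_chirp (-k) (-m)).comp (hasTemperateGrowth_affine s⁻¹ (-(s⁻¹ * d)))))
    obtain ⟨f, hf⟩ := exists_schwartz_weighted hσ (inv_ne_zero hs) (-(s⁻¹ * d)) htg' g
    refine ⟨f, SchwartzMap.ext fun x => ?_⟩
    have hx : s⁻¹ * (s * x + d) + -(s⁻¹ * d) = x := by field_simp; ring
    rw [hu, hf, hx, map_mul, RingHomInvPair.comp_apply_eq, RingHomInvPair.comp_apply_eq]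
    linear_combination (((√|s| : ℝ) : ℂ) * ((√|s| : ℝ) : ℂ)⁻¹ * g x) * chirp_mul_chirp_neg k m x +
      g x * mul_inv_cancel₀ hs0
  · intro f
    refine Lp.ext ?_
    filter_upwards [weightedEquiv_coeFn hσ hs d (measurable_metaplectic_weight s k m)
      (norm_metaplectic_weight s k m) (schwartzToH f), schwartzToH_coeFn (u f),
      (quasiMeasurePreserving_affine hs d).ae (schwartzToH_coeFn f)] with x h1 h2 h3
    rw [h2, hu, ← h3]
    exact h1
  · intro f
    ext x
    have hder : HasDerivAt (u f) (((√|s| : ℝ) : ℂ) * (Complex.I * (k + m * x) * chirp k m x) *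
        σ (f (s * x + d)) + ((√|s| : ℝ) : ℂ) * chirp k m x * σ (s * deriv f (s * x + d))) x := by
      have h1 : HasDerivAt (fun x : ℝ => s * x + d) s x := by
        simpa using ((hasDerivAt_id x).const_mul s).add_const d
      have h2 : HasDerivAt (fun x : ℝ => f (s * x + d)) (s * deriv f (s * x + d)) x := by
        have h := HasDerivAt.scomp (g₁ := f) x (f.hasDerivAt (s * x + d)) h1
        rw [Complex.real_smul] at h
        exact h
      have h3 := ((hasDerivAt_chirp k m x).const_mul ((√|s| : ℝ) : ℂ)).mul
        (hasDerivAt_of_id_or_conj hσ h2)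
      have h4 : (u f : ℝ → ℂ) = fun x => ((√|s| : ℝ) : ℂ) * chirp k m x * σ (f (s * x + d)) :=
        funext (hu f)
      rw [h4]
      exact h3
    rw [smul_apply, phaseS_apply, hder.deriv, hu, hu, phaseS_apply]
    simp only [map_add, map_mul, map_neg, ofReal_of_id_or_conj hσ, hε, smul_eq_mul]
    have ha' : (r : ℂ) * (a * s) = a' + b' * m := by exact_mod_cast ha
    have hb' : (r : ℂ) * (ε * b) = b' * s := by exact_mod_cast hb
    have hc' : (r : ℂ) * (a * d + c) = b' * k + c' := by exact_mod_cast hc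
    generalize σ (f (s * x + d)) = F
    generalize σ (deriv f (s * x + d)) = F'
    generalize chirp k m x = e
    generalize ((√|s| : ℝ) : ℂ) = w
    push_cast
    linear_combination (w * e * F * x) * ha' - (w * e * Complex.I * F') * hb' + (w * e * F) * hc' +
      (b' * (k + m * x) * w * e * F) * Complex.I_sq

end Metaplectic

/-! ### The ultrafast and the ultraslow problem -/

theorem ofReal_one_smul (ψ : H) : ((1 : ℝ) : ℂ) • ψ = ψ := by
  rw [Complex.ofReal_one, one_smul]

/-- The unitary operator that takes the standard problem to the ultrafast problem; `s = √(M / ΔT)`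
and `t = √(ΔT / M)`. -/
theorem exists_unitary_ultrafast {L a s t : ℝ} (hs : 0 < s) (ht : 0 < t) (hst : t * s = 1) :
    ∃ V : H ≃ₗᵢ[ℂ] H,
      ConjEq V X (phaseOp s 0 (-(s * L))) ∧
      ConjEq V P (phaseOp 0 t (-(s * (a - L)))) ∧
      conj V '' states (Set.Icc (-(s * L)) 0) = states (Set.Icc 0 L) ∧
      conj V OmegaStd =
        heaviside (phaseOp 1 (t ^ 2) (-a)) - heaviside (phaseOp 0 (t ^ 2) (-a + L)) := by
  have hσ : RingHom.id ℂ = RingHom.id ℂ ∨ RingHom.id ℂ = starRingEnd ℂ := Or.inl rfl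
  have hε : RingHom.id ℂ Complex.I = ((1 : ℝ) : ℂ) * Complex.I := by simp
  have hst2 : t ^ 2 * s ^ 2 = 1 := by rw [← mul_pow, hst, one_pow]
  refine ⟨metaplectic hσ hs.ne' (-(s * L)) (s ^ 2 * (a - L)) 0, fun ψ χ => ?_, fun ψ χ => ?_,
    ?_, ?_⟩
  · have := metaplectic_mem_graph_iff hσ hε hs.ne' (d := -(s * L)) (k := s ^ 2 * (a - L)) (m := 0)
      one_ne_zero (a := 1) (b := 0) (c := 0) (a' := s) (b' := 0) (c' := -(s * L))
      (by ring) (by ring) (by ring) ψ χ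
    rwa [ofReal_one_smul] at this
  · have := metaplectic_mem_graph_iff hσ hε hs.ne' (d := -(s * L)) (k := s ^ 2 * (a - L)) (m := 0)
      one_ne_zero (a := 0) (b := 1) (c := 0) (a' := 0) (b' := t) (c' := -(s * (a - L)))
      (by ring) (by linear_combination -hst) (by linear_combination -(s * (a - L)) * hst) ψ χ
    rwa [ofReal_one_smul] at this
  · refine conj_image_states hσ _ fun ψ => weightedEquiv_support hσ hs.ne' _ _ _ (fun x => ?_) ψ
    simp only [Set.mem_Icc]
    constructor
    · rintro ⟨h1, h2⟩; constructor <;> nlinarith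
    · rintro ⟨h1, h2⟩; constructor <;> nlinarith
  · rw [OmegaStd, conj_sub]
    congr 1
    · exact conj_heaviside hσ _ ht (metaplectic_mem_graph_iff hσ hε hs.ne' ht.ne'
        (by linear_combination hst) (by linear_combination -t * hst)
        (by linear_combination -L * hst - (a - L) * hst2))
    · exact conj_heaviside hσ _ ht (metaplectic_mem_graph_iff hσ hε hs.ne' ht.ne'
        (by ring) (by linear_combination -t * hst)
        (by linear_combination -(a - L) * hst2))

/-- The anti-unitary operator that takes the standard problem to the ultraslow problem;
`s = √(M / ΔT)` and `t = √(ΔT / M)`. -/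
theorem exists_antiunitary_ultraslow {L a s t : ℝ} (hs : 0 < s) (ht : 0 < t) (hst : t * s = 1) :
    ∃ U : H ≃ₛₗᵢ[starRingEnd ℂ] H,
      ConjEq U X (phaseOp (-s) 0 0) ∧
      ConjEq U P (phaseOp s t (-(s * a))) ∧
      conj U '' states (Set.Icc (-(s * L)) 0) = states (Set.Icc 0 L) ∧
      conj U OmegaStd =
        heaviside (phaseOp 0 (t ^ 2) (-a)) - heaviside (phaseOp 1 (t ^ 2) (-a)) := by
  have hσ : starRingEnd ℂ = RingHom.id ℂ ∨ starRingEnd ℂ = starRingEnd ℂ := Or.inr rfl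
  have hε : starRingEnd ℂ Complex.I = ((-1 : ℝ) : ℂ) * Complex.I := by simp
  have hst2 : t ^ 2 * s ^ 2 = 1 := by rw [← mul_pow, hst, one_pow]
  have hs' : -s ≠ 0 := neg_ne_zero.2 hs.ne'
  refine ⟨metaplectic hσ hs' 0 (s ^ 2 * a) (-s ^ 2), fun ψ χ => ?_, fun ψ χ => ?_, ?_, ?_⟩
  · have := metaplectic_mem_graph_iff hσ hε hs' (d := 0) (k := s ^ 2 * a) (m := -s ^ 2)
      one_ne_zero (a := 1) (b := 0) (c := 0) (a' := -s) (b' := 0) (c' := 0)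
      (by ring) (by ring) (by ring) ψ χ
    rwa [ofReal_one_smul] at this
  · have := metaplectic_mem_graph_iff hσ hε hs' (d := 0) (k := s ^ 2 * a) (m := -s ^ 2)
      one_ne_zero (a := 0) (b := 1) (c := 0) (a' := s) (b' := t) (c' := -(s * a))
      (by linear_combination s * hst) (by linear_combination hst)
      (by linear_combination -(s * a) * hst) ψ χ
    rwa [ofReal_one_smul] at this
  · refine conj_image_states hσ _ fun ψ => weightedEquiv_support hσ hs' _ _ _ (fun x => ?_) ψ
    simp only [Set.mem_Icc]
    constructor
    · rintro ⟨h1, h2⟩; constructor <;> nlinarith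
    · rintro ⟨h1, h2⟩; constructor <;> nlinarith
  · rw [OmegaStd, conj_sub]
    congr 1
    · exact conj_heaviside hσ _ ht (metaplectic_mem_graph_iff hσ hε hs' ht.ne'
        (by linear_combination hst2 - hst) (by linear_combination t * hst)
        (by linear_combination -a * hst2))
    · exact conj_heaviside hσ _ ht (metaplectic_mem_graph_iff hσ hε hs' ht.ne'
        (by linear_combination hst2) (by linear_combination t * hst)
        (by linear_combination -a * hst2))

end Projectile

end

theorem mainTheorem1 (M L ΔT : ℝ) (hM : 0 < M) (hL : 0 < L) (hT : 0 < ΔT) (a : ℝ) :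
    -- the three suprema are suprema of non-empty bounded sets of real numbers
    IsLUB (Projectile.values (Set.Icc (-√(M * L ^ 2 / ΔT)) 0) Projectile.OmegaStd)
      (Projectile.phi (M * L ^ 2 / ΔT)) ∧
    IsLUB (Projectile.values (Set.Icc 0 L) (Projectile.OmegaF M L a ΔT))
      (Projectile.phiF M L a ΔT) ∧
    IsLUB (Projectile.values (Set.Icc 0 L) (Projectile.OmegaS M a ΔT))
      (Projectile.phiS M L a ΔT) ∧
    -- ultrafast problem
    Projectile.phiF M L a ΔT = Projectile.phi (M * L ^ 2 / ΔT) ∧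
    (∀ a' : ℝ, Projectile.phiF M L a' ΔT = Projectile.phiF M L a ΔT) ∧
    -- ultraslow problem
    Projectile.phiS M L a ΔT = Projectile.phi (M * L ^ 2 / ΔT) ∧
    -- the unitary metaplectic map from the standard problem to the ultrafast problem
    (∃ V : Projectile.H ≃ₗᵢ[ℂ] Projectile.H,
      Projectile.ConjEq V Projectile.X (Projectile.phaseOp √(M / ΔT) 0 (-(√(M / ΔT) * L))) ∧
      Projectile.ConjEq V Projectile.P
        (Projectile.phaseOp 0 √(ΔT / M) (-(√(M / ΔT) * (a - L)))) ∧
      Projectile.conj V '' Projectile.states (Set.Icc (-√(M * L ^ 2 / ΔT)) 0) =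
        Projectile.states (Set.Icc 0 L) ∧
      Projectile.conj V Projectile.OmegaStd = Projectile.OmegaF M L a ΔT) ∧
    -- the anti-unitary metaplectic map from the standard problem to the ultraslow problem
    (∃ U : Projectile.H ≃ₛₗᵢ[starRingEnd ℂ] Projectile.H,
      Projectile.ConjEq U Projectile.X (Projectile.phaseOp (-√(M / ΔT)) 0 0) ∧
      Projectile.ConjEq U Projectile.P
        (Projectile.phaseOp √(M / ΔT) √(ΔT / M) (-(√(M / ΔT) * a))) ∧
      Projectile.conj U '' Projectile.states (Set.Icc (-√(M * L ^ 2 / ΔT)) 0) =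
        Projectile.states (Set.Icc 0 L) ∧
      Projectile.conj U Projectile.OmegaStd = Projectile.OmegaS M a ΔT) := by
  set s := √(M / ΔT) with hs_def
  set t := √(ΔT / M) with ht_def
  have hs : 0 < s := Real.sqrt_pos.2 (by positivity)
  have ht : 0 < t := Real.sqrt_pos.2 (by positivity)
  have hst : t * s = 1 := by
    rw [hs_def, ht_def, ← Real.sqrt_mul (by positivity), div_mul_div_cancel₀ hM.ne',
      div_self hT.ne', Real.sqrt_one]
  have ht2 : t ^ 2 = ΔT / M := Real.sq_sqrt (by positivity)
  have hα : √(M * L ^ 2 / ΔT) = s * L := by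
    rw [mul_div_right_comm, Real.sqrt_mul (by positivity), Real.sqrt_sq hL.le]
  have fast : ∀ a : ℝ, ∃ V : Projectile.H ≃ₗᵢ[ℂ] Projectile.H,
      Projectile.ConjEq V Projectile.X (Projectile.phaseOp s 0 (-(s * L))) ∧
      Projectile.ConjEq V Projectile.P (Projectile.phaseOp 0 t (-(s * (a - L)))) ∧
      Projectile.conj V '' Projectile.states (Set.Icc (-√(M * L ^ 2 / ΔT)) 0) =
        Projectile.states (Set.Icc 0 L) ∧
      Projectile.conj V Projectile.OmegaStd = Projectile.OmegaF M L a ΔT := fun a => by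
    rw [hα, Projectile.OmegaF, ← ht2]
    exact Projectile.exists_unitary_ultrafast hs ht hst
  have slow : ∃ U : Projectile.H ≃ₛₗᵢ[starRingEnd ℂ] Projectile.H,
      Projectile.ConjEq U Projectile.X (Projectile.phaseOp (-s) 0 0) ∧
      Projectile.ConjEq U Projectile.P (Projectile.phaseOp s t (-(s * a))) ∧
      Projectile.conj U '' Projectile.states (Set.Icc (-√(M * L ^ 2 / ΔT)) 0) =
        Projectile.states (Set.Icc 0 L) ∧
      Projectile.conj U Projectile.OmegaStd = Projectile.OmegaS M a ΔT := by
    rw [hα, Projectile.OmegaS, ← ht2]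
    exact Projectile.exists_antiunitary_ultraslow hs ht hst
  have valF : ∀ a : ℝ, Projectile.values (Set.Icc 0 L) (Projectile.OmegaF M L a ΔT) =
      Projectile.values (Set.Icc (-√(M * L ^ 2 / ΔT)) 0) Projectile.OmegaStd := fun a => by
    obtain ⟨V, -, -, h1, h2⟩ := fast a
    exact Projectile.values_eq_of_conj (Or.inl rfl) V h1 h2
  have valS : Projectile.values (Set.Icc 0 L) (Projectile.OmegaS M a ΔT) =
      Projectile.values (Set.Icc (-√(M * L ^ 2 / ΔT)) 0) Projectile.OmegaStd := by
    obtain ⟨U, -, -, h1, h2⟩ := slow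
    exact Projectile.values_eq_of_conj (Or.inr rfl) U h1 h2
  have phiF_eq : ∀ a : ℝ, Projectile.phiF M L a ΔT = Projectile.phi (M * L ^ 2 / ΔT) := fun a => by
    rw [Projectile.phiF, valF, Projectile.phi]
  have phiS_eq : Projectile.phiS M L a ΔT = Projectile.phi (M * L ^ 2 / ΔT) := by
    rw [Projectile.phiS, valS, Projectile.phi]
  have lub : IsLUB (Projectile.values (Set.Icc (-√(M * L ^ 2 / ΔT)) 0) Projectile.OmegaStd)
      (Projectile.phi (M * L ^ 2 / ΔT)) := by
    refine isLUB_csSup ?_ (Projectile.bddAbove_values _ _)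
    obtain ⟨ρ, hρ⟩ := Projectile.nonempty_states (R := Set.Icc (-√(M * L ^ 2 / ΔT)) 0)
      measurableSet_Icc (by rw [Real.volume_Icc, hα]; simp; positivity)
      (by rw [Real.volume_Icc]; exact ENNReal.ofReal_ne_top)
    exact ⟨_, ρ, hρ, rfl⟩
  refine ⟨lub, ?_, ?_, phiF_eq a, fun a' => (phiF_eq a').trans (phiF_eq a).symm, phiS_eq,
    fast a, slow⟩
  · rw [valF, phiF_eq]; exact lub
  · rw [valS, phiS_eq]; exact lub
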